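/- **Setting.** Let $X$ be a 2-dimensional smooth (Hausdorff) manifold with a smooth Lorentzian metric, oriented and time-oriented. An open subset $Y\subseteq X$ is *globally hyperbolic* if it is strongly causal and $J_Y^+(p)\cap J_Y^-(q)$ is compact for all $p,q\in Y$, where $J_Y^\pm$ denotes causal future and past with respect to causal curves inside $Y$. *Causal subsets.* A *causal subset* of an open set $W\subseteq X$ is a set $O=\operatorname{int}\bigl(J_{Y'}^+(p)\cap J_{Y'}^-(q)\bigr)$ with $Y'\subseteq W$ globally hyperbolic and $p,q\in Y'$, for which $J_{Y'}^+(p)\cap J_{Y'}^-(q)$ is a causal diamond: a nondegenerate closed rectangle $[u_0,u_1]\times[v_0,v_1]$ in null coordinates $(u,v)$ defined near it, where $\partial_u$ is future-directed, lightlike and right-pointing and $\partial_v$ is future-directed, lightlike and left-pointing. Its left corner is $x=(u_0,v_1)$, its right corner is $y=(u_1,v_0)$; its past boundary is the path $x\to p\to y$ and its future boundary is the path $x\to q\to y$ along the sides. $S(W)$ is the poset of causal subsets of $W$ under inclusion. *Paths.* $P_2(X)$ is the strict 2-category whose objects are the points of $X$, whose 1-morphisms are the piecewise lightlike right-moving paths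 (up to reparametrization), and whose 2-morphisms are generated under gluing along common boundaries by the closures of causal subsets of $X$, each regarded as a 2-morphism from its future boundary to its past boundary; a glued region is determined by its upper and lower boundary path, so there is at most one 2-morphism between two given paths. *The net.* Let $C$ be a bicategory all of whose 2-morphisms are invertible and let $Z:P_2(X)\to C$ be a (pseudo) 2-functor. For $O\in S(X)$ with past boundary $\gamma_O:x\to y$ put $\mathcal A_Z(O)=\operatorname{End}_C(Z(\gamma_O))$. For $O'\subseteq O$ with corners $x',y'$ of $O'$, let $l:x\to x'$ be the path that runs along $\gamma_O$ to the lightlike projection of $x'$ and then up to $x'$, let $r:y'\to y$ be the path that runs down to the lightlike projection of $y'$ on $\gamma_O$ and then along $\gamma_O$, and let $f'$ be the 2-morphism from the composite path $x\xrightarrow{l}x'\xrightarrow{\gamma_{O'}}y'\xrightarrow{r}y$ to $\gamma_O$. Then $\mathcal A_Z(O')\to\mathcal A_Z(O)$ sends $a$ to $Z(f')\circ a'\circ Z(f')^{-1}$, where $a'$ is $a$ whiskered with $Z(l)$ and $Z(r)$ (and transported along the coherence isomorphisms of $Z$). *Axioms.* Let $Y\subseteq X$ be open. An assignment $\mathcal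 A$ of monoids to the objects and of homomorphisms to the inclusions of $S(Y)$ is a *net* if it is a functor that sends all inclusions to injections. The net is *local* if for $O_1,O_2\subseteq O$ in $S(Y)$ such that no point of $O_1$ is joined to a point of $O_2$ by a causal curve in $Y$, the images of $\mathcal A(O_1)$ and $\mathcal A(O_2)$ in $\mathcal A(O)$ commute. It satisfies the *time-slice axiom* if, for every $O\in S(Y)$, every Cauchy surface $\Sigma$ of $O$ (a subset met exactly once by every inextendible causal curve in $O$) and every collection of causal subsets $O_i\subseteq O$ in $S(Y)$ covering $\Sigma$, the union of the images of the $\mathcal A(O_i)$ in $\mathcal A(O)$ is $\mathcal A(O)$. **Proposition.** 1. If $C$ is a 2-groupoid (all 1-morphisms are invertible up to 2-isomorphism, and all 2-morphisms are invertible), then $\mathcal A_Z$ is a net on $S(X)$, and for every globally hyperbolic open subset $Y\subseteq X$ its restriction to $S(Y)$ is a local net that satisfies the time-slice axiom. That is, $\mathcal A_Z$ is locally local and satisfies the local time-slice axiom. 2. If only the 2-morphisms of $C$ are assumed to be invertible, but horizontal composition with the images under $Z$ of 1-morphisms is injective on 2-morphisms of $C$, then $\mathcal A_Z$ is still a net on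 $S(X)$, and for every globally hyperbolic open subset $Y\subseteq X$ its restriction to $S(Y)$ is a local net. -/

import Mathlib

open Set Filter Topology CategoryTheory
open scoped Manifold ContDiff Bicategory

universe u w w₁ v₁ u₁

noncomputable section

/-! ### Oriented and time-oriented Lorentzian surfaces -/

/-- A smooth Lorentzian metric of signature `(-,+)` on the surface `X`, together with a time
orientation (given by a timelike vector field) and an orientation (given by a nowhere vanishing
2-form). In dimension two a quadratic form that takes both signs is nondegenerate of
signature `(1,1)`. -/
structure LorentzSurface (X : Type u) [TopologicalSpace X]
    [ChartedSpace (EuclideanSpace ℝ (Fin 2)) X] [IsManifold (𝓡 2) ∞ X] where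
  /-- the metric -/
  g (x : X) : TangentSpace (𝓡 2) x →L[ℝ] TangentSpace (𝓡 2) x →L[ℝ] ℝ
  g_symm (x : X) (v w : TangentSpace (𝓡 2) x) : g x v w = g x w v
  g_smooth : ContMDiff (𝓡 2)
    ((𝓡 2).prod 𝓘(ℝ, EuclideanSpace ℝ (Fin 2) →L[ℝ] EuclideanSpace ℝ (Fin 2) →L[ℝ] ℝ)) ∞
    (fun x ↦ Bundle.TotalSpace.mk'
      (EuclideanSpace ℝ (Fin 2) →L[ℝ] EuclideanSpace ℝ (Fin 2) →L[ℝ] ℝ) x (g x))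
  exists_spacelike (x : X) : ∃ v : TangentSpace (𝓡 2) x, 0 < g x v v
  /-- the time orientation -/
  T (x : X) : TangentSpace (𝓡 2) x
  T_timelike (x : X) : g x (T x) (T x) < 0
  T_continuous : Continuous (fun x ↦ (⟨x, T x⟩ : TangentBundle (𝓡 2) X))
  /-- the orientation -/
  vol (x : X) : TangentSpace (𝓡 2) x →L[ℝ] TangentSpace (𝓡 2) x →L[ℝ] ℝ
  vol_alternating (x : X) (v : TangentSpace (𝓡 2) x) : vol x v v = 0
  vol_ne_zero (x : X) : vol x ≠ 0
  vol_continuous : Continuous (fun x ↦ Bundle.TotalSpace.mk'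
      (EuclideanSpace ℝ (Fin 2) →L[ℝ] EuclideanSpace ℝ (Fin 2) →L[ℝ] ℝ) x (vol x))

variable {X : Type u} [TopologicalSpace X]
  [ChartedSpace (EuclideanSpace ℝ (Fin 2)) X] [IsManifold (𝓡 2) ∞ X]

/-- The curve `γ`, restricted to `s`, has velocity `v` at the parameter `t`. -/
def HasVelocity (γ : ℝ → X) (s : Set ℝ) (t : ℝ) (v : TangentSpace (𝓡 2) (γ t)) : Prop :=
  HasMFDerivWithinAt 𝓘(ℝ, ℝ) (𝓡 2) γ s t ((1 : ℝ →L[ℝ] ℝ).smulRight v)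

namespace LorentzSurface

variable (M : LorentzSurface X)

/-- Nonzero null vectors. -/
def Lightlike {x : X} (v : TangentSpace (𝓡 2) x) : Prop := v ≠ 0 ∧ M.g x v v = 0

/-- Nonzero timelike or lightlike vectors that point to the future. -/
def FutureCausal {x : X} (v : TangentSpace (𝓡 2) x) : Prop :=
  v ≠ 0 ∧ M.g x v v ≤ 0 ∧ M.g x v (M.T x) < 0

/-- `v` points to the right: the pair (`v`, future) is positively oriented. -/
def Rightward {x : X} (v : TangentSpace (𝓡 2) x) : Prop := 0 < M.vol x v (M.T x)

/-- `v` points to the left. -/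
def Leftward {x : X} (v : TangentSpace (𝓡 2) x) : Prop := M.vol x v (M.T x) < 0

/-! ### Causality -/

/-- `q` is reached from `p` by a `C¹` future-directed causal curve that stays in `Y`. -/
def CausalStep (Y : Set X) (p q : X) : Prop :=
  ∃ (γ : ℝ → X) (a b : ℝ), a < b ∧ γ a = p ∧ γ b = q ∧
    ContMDiffOn 𝓘(ℝ, ℝ) (𝓡 2) 1 γ (Icc a b) ∧
    ∀ t ∈ Icc a b, γ t ∈ Y ∧ ∃ v, HasVelocity γ (Icc a b) t v ∧ M.FutureCausal v

/-- The causal order of `Y`: `p = q`, or `q` is reached from `p` by a piecewise `C¹`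
future-directed causal curve in `Y`. -/
def CausalLE (Y : Set X) : X → X → Prop := Relation.ReflTransGen (M.CausalStep Y)

/-- The causal future of `p` in `Y`. -/
def future (Y : Set X) (p : X) : Set X := {r | M.CausalLE Y p r}

/-- The causal past of `q` in `Y`. -/
def past (Y : Set X) (q : X) : Set X := {r | M.CausalLE Y r q}

/-- An open subset `Y` that is globally hyperbolic in its own right: strongly causal (causal curves
of `Y` that start and end close to a point stay close to it), with compact causal intervals. -/
structure GloballyHyperbolic (Y : Set X) : Prop where
  isOpen : IsOpen Y
  stronglyCausal : ∀ p ∈ Y, ∀ U ∈ 𝓝 p, ∃ V ∈ 𝓝 p, ∀ a ∈ V ∩ Y, ∀ b ∈ V ∩ Y, ∀ c,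
    M.CausalLE Y a c → M.CausalLE Y c b → c ∈ U
  isCompact : ∀ p ∈ Y, ∀ q ∈ Y, IsCompact (M.future Y p ∩ M.past Y q)

/-- Two subsets are spacelike separated in `Y` if no point of the one is joined to a point of the
other by a causal curve in `Y`. -/
def SpacelikeSeparated (Y O₁ O₂ : Set X) : Prop :=
  ∀ x₁ ∈ O₁, ∀ x₂ ∈ O₂, ¬ M.CausalLE Y x₁ x₂ ∧ ¬ M.CausalLE Y x₂ x₁

/-- A causal curve in `O` without endpoints in `O`. -/
structure InextendibleCausalCurve (O : Set X) (γ : ℝ → X) : Prop where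
  contMDiff : ContMDiff 𝓘(ℝ, ℝ) (𝓡 2) 1 γ
  mem (t : ℝ) : γ t ∈ O
  causal (t : ℝ) : ∃ v, HasVelocity γ univ t v ∧ M.FutureCausal v
  no_future_endpoint : ∀ r ∈ O, ¬ Tendsto γ atTop (𝓝 r)
  no_past_endpoint : ∀ r ∈ O, ¬ Tendsto γ atBot (𝓝 r)

/-- A Cauchy surface of `O`: a subset that every inextendible causal curve in `O` meets
exactly once. -/
def IsCauchySurface (O Sig : Set X) : Prop :=
  Sig ⊆ O ∧ ∀ γ, M.InextendibleCausalCurve O γ → ∃! t, γ t ∈ Sig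

/-! ### Causal subsets -/

/-- The differential at `z` of the inverse of a chart: it sends `(1, 0)` and `(0, 1)` to the
coordinate vectors. -/
def frame (e : OpenPartialHomeomorph X (ℝ × ℝ)) (z : ℝ × ℝ) :
    ℝ × ℝ →L[ℝ] TangentSpace (𝓡 2) (e.symm z) :=
  mfderiv 𝓘(ℝ, ℝ × ℝ) (𝓡 2) e.symm z

/-- Null coordinates `(u, v)` on an open part of `X`: the coordinate lines of `u` are lightlike
and run to the future and to the right, those of `v` are lightlike and run to the future and
to the left. -/
structure NullChart where
  toChart : OpenPartialHomeomorph X (ℝ × ℝ)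
  smooth : ContMDiffOn (𝓡 2) 𝓘(ℝ, ℝ × ℝ) ∞ toChart toChart.source
  smooth_symm : ContMDiffOn 𝓘(ℝ, ℝ × ℝ) (𝓡 2) ∞ toChart.symm toChart.target
  du_lightlike : ∀ z ∈ toChart.target, M.Lightlike (frame toChart z (1, 0))
  du_future : ∀ z ∈ toChart.target, M.FutureCausal (frame toChart z (1, 0))
  du_right : ∀ z ∈ toChart.target, M.Rightward (frame toChart z (1, 0))
  dv_lightlike : ∀ z ∈ toChart.target, M.Lightlike (frame toChart z (0, 1))
  dv_future : ∀ z ∈ toChart.target, M.FutureCausal (frame toChart z (0, 1))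
  dv_left : ∀ z ∈ toChart.target, M.Leftward (frame toChart z (0, 1))

/-- A causal diamond: two points `p`, `q` of a globally hyperbolic subset `Y` for which the
intersection of the future of `p` with the past of `q` is a (nondegenerate) rectangle with lightlike
sides, that is, a rectangle in null coordinates. This rules out intersections without a left and a
right corner, such as those that wrap around a cylinder. -/
structure CausalDiamond where
  Y : Set X
  hyperbolic : M.GloballyHyperbolic Y
  p : X
  q : X
  p_mem : p ∈ Y
  q_mem : q ∈ Y
  chart : NullChart M
  u₀ : ℝ
  u₁ : ℝ
  v₀ : ℝ
  v₁ : ℝ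
  u_lt : u₀ < u₁
  v_lt : v₀ < v₁
  rect_subset : Icc u₀ u₁ ×ˢ Icc v₀ v₁ ⊆ chart.toChart.target
  p_eq : chart.toChart.symm (u₀, v₀) = p
  q_eq : chart.toChart.symm (u₁, v₁) = q
  inter_eq : M.future Y p ∩ M.past Y q = chart.toChart.symm '' (Icc u₀ u₁ ×ˢ Icc v₀ v₁)

/-- The causal subset of a causal diamond: the interior of the intersection of the future of `p`
with the past of `q`. -/
def CausalDiamond.region {M : LorentzSurface X} (D : CausalDiamond M) : Set X :=
  interior (M.future D.Y D.p ∩ M.past D.Y D.q)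

/-! ### The 2-category of paths -/

/-- A piece of a path: a `C¹` lightlike right-moving curve, or a constant curve (`a = b`). -/
structure Segment (x y : X) where
  γ : ℝ → X
  a : ℝ
  b : ℝ
  le : a ≤ b
  source_eq : γ a = x
  target_eq : γ b = y
  contMDiffOn : ContMDiffOn 𝓘(ℝ, ℝ) (𝓡 2) 1 γ (Icc a b)
  lightlike : a < b → ∀ t ∈ Icc a b,
    ∃ v, HasVelocity γ (Icc a b) t v ∧ M.Lightlike v ∧ M.Rightward v

/-- The points of `X`, as vertices of the quiver of lightlike right-moving segments. -/
def Vertex (_ : LorentzSurface X) : Type u := X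

instance : Quiver (Vertex M) := ⟨fun x y ↦ Segment M (show X from x) (show X from y)⟩

/-- A segment as a one-letter word. -/
def Segment.word {M : LorentzSurface X} {x y : X} (s : Segment M x y) :
    (show Paths (Vertex M) from x) ⟶ (show Paths (Vertex M) from y) :=
  (Paths.of (Vertex M)).map s

/-- Two words of segments describe the same path: this is generated by reparametrization,
by cutting a segment into two, and by dropping constant segments. -/
inductive SamePath : HomRel (Paths (Vertex M))
  | reparam {x y : X} (s s' : Segment M x y) (φ : ℝ → ℝ) (hc : ContinuousOn φ (Icc s.a s.b))
      (hm : StrictMonoOn φ (Icc s.a s.b)) (ha : φ s.a = s'.a) (hb : φ s.b = s'.b)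
      (h : ∀ t ∈ Icc s.a s.b, s.γ t = s'.γ (φ t)) : SamePath s.word s'.word
  | cut {x y z : X} (s : Segment M x z) (s₁ : Segment M x y) (s₂ : Segment M y z)
      (ha : s₁.a = s.a) (hc : s₁.b = s₂.a) (hb : s₂.b = s.b)
      (h₁ : EqOn s₁.γ s.γ (Icc s₁.a s₁.b)) (h₂ : EqOn s₂.γ s.γ (Icc s₂.a s₂.b)) :
      SamePath s.word (s₁.word ≫ s₂.word)
  | const {x : X} (s : Segment M x x) (h : s.a = s.b) : SamePath s.word (𝟙 _)

/-- The objects of the path 2-category: the points of `X`. -/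
@[ext]
structure PathTwoCat (M : LorentzSurface X) where
  pt : X

/-- The 1-morphisms are the piecewise lightlike right-moving paths, up to reparametrization. -/
instance : Category (PathTwoCat M) where
  Hom x y := (⟨(show Paths (Vertex M) from x.pt)⟩ : CategoryTheory.Quotient (SamePath M)) ⟶
    (⟨(show Paths (Vertex M) from y.pt)⟩ : CategoryTheory.Quotient (SamePath M))
  id x := 𝟙 (⟨(show Paths (Vertex M) from x.pt)⟩ : CategoryTheory.Quotient (SamePath M))
  comp f g := CategoryStruct.comp (obj := CategoryTheory.Quotient (SamePath M)) f g
  id_comp f := Category.id_comp (obj := CategoryTheory.Quotient (SamePath M)) f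
  comp_id f := Category.comp_id (obj := CategoryTheory.Quotient (SamePath M)) f
  assoc f g h := Category.assoc (obj := CategoryTheory.Quotient (SamePath M)) f g h

variable {M}

/-- The path that consists of one segment. -/
def Segment.path {x y : X} (s : Segment M x y) :
    (⟨x⟩ : PathTwoCat M) ⟶ ⟨y⟩ :=
  (CategoryTheory.Quotient.functor (SamePath M)).map s.word

lemma Segment.path_reparam {x y : X} (s s' : Segment M x y) (φ : ℝ → ℝ)
    (hc : ContinuousOn φ (Icc s.a s.b))
    (hm : StrictMonoOn φ (Icc s.a s.b)) (ha : φ s.a = s'.a) (hb : φ s.b = s'.b)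
    (h : ∀ t ∈ Icc s.a s.b, s.γ t = s'.γ (φ t)) : s.path = s'.path :=
  CategoryTheory.Quotient.sound _ (SamePath.reparam s s' φ hc hm ha hb h)

lemma Segment.path_cut {x y z : X} (s : Segment M x z) (s₁ : Segment M x y) (s₂ : Segment M y z)
    (ha : s₁.a = s.a) (hc : s₁.b = s₂.a) (hb : s₂.b = s.b)
    (h₁ : EqOn s₁.γ s.γ (Icc s₁.a s₁.b)) (h₂ : EqOn s₂.γ s.γ (Icc s₂.a s₂.b)) :
    s.path = s₁.path ≫ s₂.path :=
  CategoryTheory.Quotient.sound _ (SamePath.cut s s₁ s₂ ha hc hb h₁ h₂)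

lemma Segment.path_const {x : X} (s : Segment M x x) (h : s.a = s.b) : s.path = 𝟙 _ :=
  CategoryTheory.Quotient.sound _ (SamePath.const s h)

namespace NullChart

variable (e : NullChart M)

lemma mdifferentiableAt_symm {z : ℝ × ℝ} (hz : z ∈ e.toChart.target) :
    MDifferentiableAt 𝓘(ℝ, ℝ × ℝ) (𝓡 2) e.toChart.symm z :=
  ((e.smooth_symm z hz).contMDiffAt (e.toChart.open_target.mem_nhds hz)).mdifferentiableAt
    (by simp)

lemma mdifferentiableAt {x : X} (hx : x ∈ e.toChart.source) :
    MDifferentiableAt (𝓡 2) 𝓘(ℝ, ℝ × ℝ) e.toChart x :=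
  ((e.smooth x hx).contMDiffAt (e.toChart.open_source.mem_nhds hx)).mdifferentiableAt
    (by simp)

/-- A `C¹` curve in coordinates. -/
lemma curve_contMDiffOn {c : ℝ → ℝ × ℝ} {s : Set ℝ} (hc : ContDiff ℝ 1 c)
    (hs : ∀ t ∈ s, c t ∈ e.toChart.target) :
    ContMDiffOn 𝓘(ℝ, ℝ) (𝓡 2) 1 (fun t ↦ e.toChart.symm (c t)) s :=
  ContMDiffOn.comp (e.smooth_symm.of_le (by simp)) hc.contMDiff.contMDiffOn hs

lemma curve_hasVelocity {c : ℝ → ℝ × ℝ} {s : Set ℝ} {t : ℝ} {d : ℝ × ℝ} (hc : HasDerivAt c d t)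
    (ht : c t ∈ e.toChart.target) :
    HasVelocity (fun t ↦ e.toChart.symm (c t)) s t (frame e.toChart (c t) d) := by
  have h1 : HasMFDerivWithinAt 𝓘(ℝ, ℝ) 𝓘(ℝ, ℝ × ℝ) c s t
      ((1 : ℝ →L[ℝ] ℝ).smulRight d : ℝ →L[ℝ] ℝ × ℝ) :=
    hc.hasFDerivAt.hasFDerivWithinAt.hasMFDerivWithinAt
  have h2 := (e.mdifferentiableAt_symm ht).hasMFDerivAt.comp_hasMFDerivWithinAt t h1
  have h3 : (mfderiv 𝓘(ℝ, ℝ × ℝ) (𝓡 2) e.toChart.symm (c t)).comp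
      ((1 : ℝ →L[ℝ] ℝ).smulRight d : ℝ →L[ℝ] ℝ × ℝ) =
      ((1 : ℝ →L[ℝ] ℝ).smulRight (frame e.toChart (c t) d) :
        ℝ →L[ℝ] TangentSpace (𝓡 2) (e.toChart.symm (c t))) := by
    ext1
    change frame e.toChart (c t) ((1 : ℝ) • d) = (1 : ℝ) • frame e.toChart (c t) d
    rw [map_smul]
  unfold HasVelocity
  exact h3 ▸ h2

/-- The segment along a coordinate line of `u`, from `(u₁, v)` up to the right to `(u₂, v)`. -/
def upSegment {u₁ u₂ v : ℝ} (h : u₁ ≤ u₂)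
    (ht : ∀ u ∈ Icc u₁ u₂, (u, v) ∈ e.toChart.target) {x y : X}
    (hx : e.toChart.symm (u₁, v) = x) (hy : e.toChart.symm (u₂, v) = y) : Segment M x y where
  γ t := e.toChart.symm (t, v)
  a := u₁
  b := u₂
  le := h
  source_eq := hx
  target_eq := hy
  contMDiffOn := e.curve_contMDiffOn (c := fun t ↦ (t, v)) (by fun_prop) ht
  lightlike _ t h := by
    have hd : HasDerivAt (fun t : ℝ ↦ (t, v)) (1, 0) t :=
      (hasDerivAt_id t).prodMk (hasDerivAt_const t v)
    exact ⟨_, e.curve_hasVelocity hd (ht t h), e.du_lightlike _ (ht t h), e.du_right _ (ht t h)⟩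

/-- The segment along a coordinate line of `v`, from `(u, v₁)` down to the right to `(u, v₂)`. -/
def downSegment {u v₁ v₂ : ℝ} (h : v₂ ≤ v₁)
    (ht : ∀ v ∈ Icc v₂ v₁, (u, v) ∈ e.toChart.target) {x y : X}
    (hx : e.toChart.symm (u, v₁) = x) (hy : e.toChart.symm (u, v₂) = y) : Segment M x y where
  γ t := e.toChart.symm (u, -t)
  a := -v₁
  b := -v₂
  le := neg_le_neg h
  source_eq := by simpa using hx
  target_eq := by simpa using hy
  contMDiffOn := e.curve_contMDiffOn (c := fun t ↦ (u, -t)) (by fun_prop)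
    fun t h ↦ ht _ ⟨by linarith [h.2], by linarith [h.1]⟩
  lightlike _ t h := by
    have hd : HasDerivAt (fun t : ℝ ↦ (u, -t)) (0, -1) t :=
      (hasDerivAt_const t u).prodMk (hasDerivAt_neg t)
    have hm := ht (-t) ⟨by linarith [h.2], by linarith [h.1]⟩
    have hn : ((0, -1) : ℝ × ℝ) = -(0, 1) := by simp
    refine ⟨_, e.curve_hasVelocity hd hm, ?_, ?_⟩
    · obtain ⟨h1, h2⟩ := e.dv_lightlike _ hm
      rw [hn]
      constructor
      · rw [map_neg]; exact neg_ne_zero.mpr h1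
      · simp only [map_neg, neg_apply, h2, neg_zero]
    · have h3 := e.dv_left _ hm
      rw [hn]
      unfold Leftward at h3
      unfold Rightward
      rw [map_neg, map_neg, neg_apply]
      linarith

end NullChart

namespace CausalDiamond

variable (D : CausalDiamond M)

/-- The left corner. -/
def left : X := D.chart.toChart.symm (D.u₀, D.v₁)

/-- The right corner. -/
def right : X := D.chart.toChart.symm (D.u₁, D.v₀)

lemma left_eq : D.chart.toChart.symm (D.u₀, D.v₁) = D.left := rfl

lemma right_eq : D.chart.toChart.symm (D.u₁, D.v₀) = D.right := rfl

lemma mem_target {u v : ℝ} (hu : u ∈ Icc D.u₀ D.u₁) (hv : v ∈ Icc D.v₀ D.v₁) :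
    (u, v) ∈ D.chart.toChart.target := D.rect_subset ⟨hu, hv⟩

/-- The path up to the right from `(u₁, v)` to `(u₂, v)` in the closed diamond. -/
def up {u₁ u₂ v : ℝ} (h₁ : D.u₀ ≤ u₁) (h : u₁ ≤ u₂) (h₂ : u₂ ≤ D.u₁) (hv₀ : D.v₀ ≤ v)
    (hv₁ : v ≤ D.v₁) {x y : X} (hx : D.chart.toChart.symm (u₁, v) = x)
    (hy : D.chart.toChart.symm (u₂, v) = y) : (⟨x⟩ : PathTwoCat M) ⟶ ⟨y⟩ :=
  (D.chart.upSegment h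
    (fun _ hu ↦ D.mem_target ⟨h₁.trans hu.1, hu.2.trans h₂⟩ ⟨hv₀, hv₁⟩) hx hy).path

/-- The path down to the right from `(u, v₁)` to `(u, v₂)` in the closed diamond. -/
def down {u v₁ v₂ : ℝ} (h₁ : v₁ ≤ D.v₁) (h : v₂ ≤ v₁) (h₂ : D.v₀ ≤ v₂) (hu₀ : D.u₀ ≤ u)
    (hu₁ : u ≤ D.u₁) {x y : X} (hx : D.chart.toChart.symm (u, v₁) = x)
    (hy : D.chart.toChart.symm (u, v₂) = y) : (⟨x⟩ : PathTwoCat M) ⟶ ⟨y⟩ :=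
  (D.chart.downSegment h
    (fun _ hv ↦ D.mem_target ⟨hu₀, hu₁⟩ ⟨h₂.trans hv.1, hv.2.trans h₁⟩) hx hy).path

/-- The past boundary, from the left corner over `p` to the right corner. -/
def pastBoundary : (⟨D.left⟩ : PathTwoCat M) ⟶ ⟨D.right⟩ :=
  D.down (u := D.u₀) le_rfl D.v_lt.le le_rfl le_rfl D.u_lt.le D.left_eq D.p_eq ≫
    D.up (v := D.v₀) le_rfl D.u_lt.le le_rfl le_rfl D.v_lt.le D.p_eq D.right_eq

/-- The future boundary, from the left corner over `q` to the right corner. -/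
def futureBoundary : (⟨D.left⟩ : PathTwoCat M) ⟶ ⟨D.right⟩ :=
  D.up (v := D.v₁) le_rfl D.u_lt.le le_rfl D.v_lt.le le_rfl D.left_eq D.q_eq ≫
    D.down (u := D.u₁) le_rfl D.v_lt.le le_rfl D.u_lt.le le_rfl D.q_eq D.right_eq

end CausalDiamond

/-- `Sweep f g`: a 2-morphism from `f` down to `g` can be glued from closed causal diamonds, each of
them a 2-morphism from its future boundary to its past boundary. -/
inductive Sweep : ∀ {x y : PathTwoCat M}, (x ⟶ y) → (x ⟶ y) → Prop
  | refl {x y : PathTwoCat M} (f : x ⟶ y) : Sweep f f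
  | trans {x y : PathTwoCat M} {f g h : x ⟶ y} : Sweep f g → Sweep g h → Sweep f h
  | diamond {x y : PathTwoCat M} (D : CausalDiamond M) (l : x ⟶ ⟨D.left⟩) (r : ⟨D.right⟩ ⟶ y) :
      Sweep (l ≫ D.futureBoundary ≫ r) (l ≫ D.pastBoundary ≫ r)

lemma Sweep.whiskerLeft {x y z : PathTwoCat M} (l : x ⟶ y) {f g : y ⟶ z} (h : Sweep f g) :
    Sweep (l ≫ f) (l ≫ g) := by
  induction h with
  | refl f => exact .refl _
  | trans _ _ ih₁ ih₂ => exact .trans ih₁ ih₂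
  | diamond D l' r => simpa using Sweep.diamond D (l ≫ l') r

lemma Sweep.whiskerRight {x y z : PathTwoCat M} {f g : x ⟶ y} (h : Sweep f g) (r : y ⟶ z) :
    Sweep (f ≫ r) (g ≫ r) := by
  induction h with
  | refl f => exact .refl _
  | trans _ _ ih₁ ih₂ => exact .trans ih₁ ih₂
  | diamond D l r' => simpa using Sweep.diamond D l (r' ≫ r)

variable (M) in
/-- 2-morphisms. A region that is glued from closed diamonds is determined by its upper and its
lower boundary path, so there is at most one 2-morphism between two given paths. -/
instance homCategory (x y : PathTwoCat M) : Category (x ⟶ y) where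
  Hom f g := PLift (Sweep f g)
  id f := ⟨.refl f⟩
  comp h k := ⟨h.down.trans k.down⟩

instance (x y : PathTwoCat M) : Quiver.IsThin (x ⟶ y) :=
  fun _ _ ↦ ⟨fun ⟨_⟩ ⟨_⟩ ↦ rfl⟩

variable (M) in
/-- The strict 2-category of paths. -/
instance : Bicategory (PathTwoCat M) where
  homCategory := homCategory M
  whiskerLeft l _ _ h := ⟨h.down.whiskerLeft l⟩
  whiskerRight h r := ⟨h.down.whiskerRight r⟩
  associator f g h := eqToIso (Category.assoc f g h)
  leftUnitor f := eqToIso (Category.id_comp f)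
  rightUnitor f := eqToIso (Category.comp_id f)
  whiskerLeft_id := by intros; exact Subsingleton.elim _ _
  whiskerLeft_comp := by intros; exact Subsingleton.elim _ _
  id_whiskerLeft := by intros; exact Subsingleton.elim _ _
  comp_whiskerLeft := by intros; exact Subsingleton.elim _ _
  id_whiskerRight := by intros; exact Subsingleton.elim _ _
  comp_whiskerRight := by intros; exact Subsingleton.elim _ _
  whiskerRight_id := by intros; exact Subsingleton.elim _ _
  whiskerRight_comp := by intros; exact Subsingleton.elim _ _
  whisker_assoc := by intros; exact Subsingleton.elim _ _
  whisker_exchange := by intros; exact Subsingleton.elim _ _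
  pentagon := by intros; exact Subsingleton.elim _ _
  triangle := by intros; exact Subsingleton.elim _ _

instance : Bicategory.Strict (PathTwoCat M) where
  id_comp := Category.id_comp
  comp_id := Category.comp_id
  assoc := Category.assoc
  leftUnitor_eqToIso _ := rfl
  rightUnitor_eqToIso _ := rfl
  associator_eqToIso _ _ _ := rfl

/-! ### Null coordinates and the causal order -/

namespace NullChart

variable (e : NullChart M)

/-- The differential of the chart. -/
def coframe (x : X) : TangentSpace (𝓡 2) x →L[ℝ] ℝ × ℝ :=
  mfderiv (𝓡 2) 𝓘(ℝ, ℝ × ℝ) e.toChart x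

lemma coframe_frame {z : ℝ × ℝ} (hz : z ∈ e.toChart.target) (d : ℝ × ℝ) :
    e.coframe (e.toChart.symm z) (frame e.toChart z d) = d := by
  have h1 := (e.mdifferentiableAt (e.toChart.map_target hz)).hasMFDerivAt.comp z
    (e.mdifferentiableAt_symm hz).hasMFDerivAt
  have h2 : HasMFDerivAt 𝓘(ℝ, ℝ × ℝ) 𝓘(ℝ, ℝ × ℝ) (e.toChart ∘ e.toChart.symm) z
      (ContinuousLinearMap.id ℝ (ℝ × ℝ)) := by
    refine (hasMFDerivAt_id z).congr_of_eventuallyEq ?_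
    filter_upwards [e.toChart.open_target.mem_nhds hz] with y hy
    exact e.toChart.right_inv hy
  have h3 := hasMFDerivAt_unique h1 h2
  exact congrArg (fun f : ℝ × ℝ →L[ℝ] ℝ × ℝ ↦ f d) h3

lemma exists_frame {z : ℝ × ℝ} (hz : z ∈ e.toChart.target)
    (w : TangentSpace (𝓡 2) (e.toChart.symm z)) : ∃ d, frame e.toChart z d = w := by
  have hinj : Function.Injective (frame e.toChart z).toLinearMap := fun a b h ↦ by
    rw [← e.coframe_frame hz a, ← e.coframe_frame hz b]
    exact congrArg _ h
  have hf : Module.finrank ℝ (ℝ × ℝ) =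
      Module.finrank ℝ (TangentSpace (𝓡 2) (e.toChart.symm z)) := by
    change _ = Module.finrank ℝ (EuclideanSpace ℝ (Fin 2))
    simp
  have : FiniteDimensional ℝ (TangentSpace (𝓡 2) (e.toChart.symm z)) :=
    inferInstanceAs (FiniteDimensional ℝ (EuclideanSpace ℝ (Fin 2)))
  exact (LinearMap.injective_iff_surjective_of_finrank_eq_finrank hf).mp hinj w

lemma frame_eq (z d : ℝ × ℝ) :
    frame e.toChart z d = d.1 • frame e.toChart z (1, 0) + d.2 • frame e.toChart z (0, 1) := by
  rw [← map_smul, ← map_smul, ← map_add]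
  simp

lemma g_frame {z : ℝ × ℝ} (hz : z ∈ e.toChart.target) (d d' : ℝ × ℝ) :
    M.g _ (frame e.toChart z d) (frame e.toChart z d') =
      (d.1 * d'.2 + d.2 * d'.1) *
        M.g _ (frame e.toChart z (1, 0)) (frame e.toChart z (0, 1)) := by
  have h1 := (e.du_lightlike z hz).2
  have h2 := (e.dv_lightlike z hz).2
  have h3 := M.g_symm _ (frame e.toChart z (0, 1)) (frame e.toChart z (1, 0))
  rw [e.frame_eq z d, e.frame_eq z d']
  simp only [map_add, map_smul, add_apply, smul_apply, h1, h2, h3, smul_eq_mul]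
  ring

lemma g_frame_neg {z : ℝ × ℝ} (hz : z ∈ e.toChart.target) :
    M.g _ (frame e.toChart z (1, 0)) (frame e.toChart z (0, 1)) < 0 := by
  obtain ⟨τ, hτ⟩ := e.exists_frame hz (M.T _)
  have h1 := (e.du_future z hz).2.2
  have h2 := (e.dv_future z hz).2.2
  have h3 := M.T_timelike (e.toChart.symm z)
  rw [← hτ, e.g_frame hz] at h1 h2 h3
  simp only [one_mul, zero_mul, add_zero, zero_add] at h1 h2
  nlinarith [mul_pos_of_neg_of_neg h1 h2]

lemma nonneg_of_futureCausal_frame {z : ℝ × ℝ} (hz : z ∈ e.toChart.target) {d : ℝ × ℝ}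
    (h : M.FutureCausal (frame e.toChart z d)) : 0 ≤ d.1 ∧ 0 ≤ d.2 := by
  obtain ⟨-, h1, h2⟩ := h
  have hm := e.g_frame_neg hz
  have ha := (e.du_future z hz).2.2
  have hb := (e.dv_future z hz).2.2
  rw [e.g_frame hz] at h1
  rw [e.frame_eq z d] at h2
  simp only [map_add, map_smul, add_apply, smul_apply, smul_eq_mul] at h2
  have h3 : 0 ≤ d.1 * d.2 := by nlinarith
  constructor <;> by_contra! hc
  · have h4 : d.2 ≤ 0 := by by_contra! h5; nlinarith
    nlinarith
  · have h4 : d.1 ≤ 0 := by by_contra! h5; nlinarith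
    nlinarith

lemma futureCausal_frame {z : ℝ × ℝ} (hz : z ∈ e.toChart.target) {d : ℝ × ℝ}
    (h1 : 0 ≤ d.1) (h2 : 0 ≤ d.2) (hd : d ≠ 0) : M.FutureCausal (frame e.toChart z d) := by
  have hm := e.g_frame_neg hz
  have ha := (e.du_future z hz).2.2
  have hb := (e.dv_future z hz).2.2
  have h3 : 0 < d.1 ∨ 0 < d.2 := by
    by_contra! hc
    exact hd (Prod.ext (le_antisymm hc.1 h1) (le_antisymm hc.2 h2))
  refine ⟨fun h0 ↦ hd ?_, ?_, ?_⟩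
  · rw [← e.coframe_frame hz d, h0, map_zero]
  · rw [e.g_frame hz]
    nlinarith [mul_nonneg h1 h2]
  · rw [e.frame_eq z d]
    simp only [map_add, map_smul, add_apply, smul_apply, smul_eq_mul]
    rcases h3 with h3 | h3 <;> nlinarith

lemma exists_of_mem_source {x : X} (hx : x ∈ e.toChart.source) :
    ∃ z ∈ e.toChart.target, e.toChart.symm z = x :=
  ⟨_, e.toChart.map_source hx, e.toChart.left_inv hx⟩

lemma coframe_nonneg {x : X} (hx : x ∈ e.toChart.source) {v : TangentSpace (𝓡 2) x}
    (h : M.FutureCausal v) : 0 ≤ (e.coframe x v).1 ∧ 0 ≤ (e.coframe x v).2 := by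
  obtain ⟨z, hz, rfl⟩ := e.exists_of_mem_source hx
  obtain ⟨d, rfl⟩ := e.exists_frame hz v
  rw [e.coframe_frame hz]
  exact e.nonneg_of_futureCausal_frame hz h

lemma coframe_right {x : X} (hx : x ∈ e.toChart.source) {v : TangentSpace (𝓡 2) x}
    (h : M.FutureCausal v) (hl : M.Lightlike v) (hr : M.Rightward v) :
    0 < (e.coframe x v).1 ∧ (e.coframe x v).2 = 0 := by
  obtain ⟨z, hz, rfl⟩ := e.exists_of_mem_source hx
  obtain ⟨d, rfl⟩ := e.exists_frame hz v
  rw [e.coframe_frame hz]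
  obtain ⟨h1, h2⟩ := e.nonneg_of_futureCausal_frame hz h
  have hm := e.g_frame_neg hz
  have ha := e.du_right z hz
  have hb := e.dv_left z hz
  have h3 := hl.2
  rw [e.g_frame hz] at h3
  unfold Rightward at ha hr
  unfold Leftward at hb
  rw [e.frame_eq z d] at hr
  simp only [map_add, map_smul, add_apply, smul_apply, smul_eq_mul] at hr
  have h4 : 0 < d.1 := by by_contra! hc; nlinarith
  have h5 : d.1 * d.2 + d.2 * d.1 = 0 := (mul_eq_zero.mp h3).resolve_right hm.ne
  exact ⟨h4, by nlinarith⟩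

lemma coframe_left {x : X} (hx : x ∈ e.toChart.source) {v : TangentSpace (𝓡 2) x}
    (h : M.FutureCausal v) (hl : M.Lightlike v) (hr : M.Leftward v) :
    (e.coframe x v).1 = 0 ∧ 0 < (e.coframe x v).2 := by
  obtain ⟨z, hz, rfl⟩ := e.exists_of_mem_source hx
  obtain ⟨d, rfl⟩ := e.exists_frame hz v
  rw [e.coframe_frame hz]
  obtain ⟨h1, h2⟩ := e.nonneg_of_futureCausal_frame hz h
  have hm := e.g_frame_neg hz
  have ha := e.du_right z hz
  have hb := e.dv_left z hz
  have h3 := hl.2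
  rw [e.g_frame hz] at h3
  unfold Rightward at ha
  unfold Leftward at hb hr
  rw [e.frame_eq z d] at hr
  simp only [map_add, map_smul, add_apply, smul_apply, smul_eq_mul] at hr
  have h4 : 0 < d.2 := by by_contra! hc; nlinarith
  have h5 : d.1 * d.2 + d.2 * d.1 = 0 := (mul_eq_zero.mp h3).resolve_right hm.ne
  exact ⟨by nlinarith, h4⟩

lemma hasDerivWithinAt_coord {γ : ℝ → X} {s : Set ℝ} {t : ℝ} {v : TangentSpace (𝓡 2) (γ t)}
    (h : HasVelocity γ s t v) (hx : γ t ∈ e.toChart.source) :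
    HasDerivWithinAt (fun t ↦ e.toChart (γ t)) (e.coframe (γ t) v) s t := by
  have h2 := (e.mdifferentiableAt hx).hasMFDerivAt.comp_hasMFDerivWithinAt t h
  have h3 : (mfderiv (𝓡 2) 𝓘(ℝ, ℝ × ℝ) e.toChart (γ t)).comp
      ((1 : ℝ →L[ℝ] ℝ).smulRight v : ℝ →L[ℝ] TangentSpace (𝓡 2) (γ t)) =
      ((1 : ℝ →L[ℝ] ℝ).smulRight (e.coframe (γ t) v) : ℝ →L[ℝ] ℝ × ℝ) := by
    ext1
    change e.coframe (γ t) ((1 : ℝ) • v) = (1 : ℝ) • e.coframe (γ t) v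
    rw [map_smul]
  have h4 := (hasMFDerivWithinAt_iff_hasFDerivWithinAt.mp h2)
  exact (h3 ▸ h4 : HasFDerivWithinAt _ ((1 : ℝ →L[ℝ] ℝ).smulRight (e.coframe (γ t) v)) s t)

lemma hasDerivWithinAt_fst {f : ℝ → ℝ × ℝ} {d : ℝ × ℝ} {s : Set ℝ} {t : ℝ}
    (h : HasDerivWithinAt f d s t) : HasDerivWithinAt (fun t ↦ (f t).1) d.1 s t :=
  (hasFDerivAt_fst (𝕜 := ℝ) (E := ℝ) (F := ℝ)).comp_hasDerivWithinAt t h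

lemma hasDerivWithinAt_snd {f : ℝ → ℝ × ℝ} {d : ℝ × ℝ} {s : Set ℝ} {t : ℝ}
    (h : HasDerivWithinAt f d s t) : HasDerivWithinAt (fun t ↦ (f t).2) d.2 s t :=
  (hasFDerivAt_snd (𝕜 := ℝ) (E := ℝ) (F := ℝ)).comp_hasDerivWithinAt t h

/-- Null coordinates increase along future-directed causal curves. -/
lemma coord_le {γ : ℝ → X} {a b : ℝ} (hab : a ≤ b) (hs : ∀ t ∈ Icc a b, γ t ∈ e.toChart.source)
    (h : ∀ t ∈ Icc a b, ∃ v, HasVelocity γ (Icc a b) t v ∧ M.FutureCausal v) :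
    e.toChart (γ a) ≤ e.toChart (γ b) := by
  have key : ∀ t ∈ Icc a b, ∃ d : ℝ × ℝ,
      HasDerivWithinAt (fun t ↦ e.toChart (γ t)) d (Icc a b) t ∧ 0 ≤ d.1 ∧ 0 ≤ d.2 := by
    intro t ht
    obtain ⟨v, hv, hc⟩ := h t ht
    exact ⟨_, e.hasDerivWithinAt_coord hv (hs t ht), e.coframe_nonneg (hs t ht) hc⟩
  have ha : a ∈ Icc a b := ⟨le_rfl, hab⟩
  have hb : b ∈ Icc a b := ⟨hab, le_rfl⟩
  choose! d hd hd1 hd2 using key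
  have hin : interior (Icc a b) ⊆ Icc a b := interior_subset
  constructor
  · refine monotoneOn_of_hasDerivWithinAt_nonneg (f := fun t ↦ (e.toChart (γ t)).1)
      (f' := fun t ↦ (d t).1) (convex_Icc a b) (fun t ht ↦ ?_) (fun t ht ↦ ?_)
      (fun t ht ↦ hd1 t (hin ht)) ha hb hab
    · exact (hasDerivWithinAt_fst (hd t ht)).continuousWithinAt
    · exact (hasDerivWithinAt_fst (hd t (hin ht))).mono hin
  · refine monotoneOn_of_hasDerivWithinAt_nonneg (f := fun t ↦ (e.toChart (γ t)).2)
      (f' := fun t ↦ (d t).2) (convex_Icc a b) (fun t ht ↦ ?_) (fun t ht ↦ ?_)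
      (fun t ht ↦ hd2 t (hin ht)) ha hb hab
    · exact (hasDerivWithinAt_snd (hd t ht)).continuousWithinAt
    · exact (hasDerivWithinAt_snd (hd t (hin ht))).mono hin

end NullChart

lemma CausalStep.sub {Y : Set X} {p q : X} {γ : ℝ → X} {a b : ℝ} (hp : γ a = p) (hq : γ b = q)
    (hc : ContMDiffOn 𝓘(ℝ, ℝ) (𝓡 2) 1 γ (Icc a b))
    (h : ∀ t ∈ Icc a b, γ t ∈ Y ∧ ∃ v, HasVelocity γ (Icc a b) t v ∧ M.FutureCausal v)
    {t : ℝ} (ht : t ∈ Icc a b) : M.CausalLE Y p (γ t) ∧ M.CausalLE Y (γ t) q := by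
  subst hp hq
  constructor
  · rcases ht.1.eq_or_lt with rfl | h1
    · exact .refl
    · have hs : Icc a t ⊆ Icc a b := Icc_subset_Icc_right ht.2
      refine .single ⟨γ, a, t, h1, rfl, rfl, hc.mono hs, fun s hs' ↦ ⟨(h s (hs hs')).1, ?_⟩⟩
      obtain ⟨v, hv, hv'⟩ := (h s (hs hs')).2
      exact ⟨v, HasMFDerivWithinAt.mono hv hs, hv'⟩
  · rcases ht.2.eq_or_lt with rfl | h1
    · exact .refl
    · have hs : Icc t b ⊆ Icc a b := Icc_subset_Icc_left ht.1
      refine .single ⟨γ, t, b, h1, rfl, rfl, hc.mono hs, fun s hs' ↦ ⟨(h s (hs hs')).1, ?_⟩⟩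
      obtain ⟨v, hv, hv'⟩ := (h s (hs hs')).2
      exact ⟨v, HasMFDerivWithinAt.mono hv hs, hv'⟩

lemma CausalLE.mem {Y : Set X} {p q : X} (hp : p ∈ Y) (h : M.CausalLE Y p q) : q ∈ Y := by
  induction h with
  | refl => exact hp
  | tail _ h _ =>
    obtain ⟨γ, a, b, hab, -, rfl, -, h⟩ := h
    exact (h b ⟨hab.le, le_rfl⟩).1

namespace CausalDiamond

variable (D : CausalDiamond M)

/-- The closed diamond. -/
def closedRegion : Set X := M.future D.Y D.p ∩ M.past D.Y D.q

lemma closedRegion_eq :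
    D.closedRegion = D.chart.toChart.symm '' (Icc D.u₀ D.u₁ ×ˢ Icc D.v₀ D.v₁) := D.inter_eq

lemma closedRegion_subset_source : D.closedRegion ⊆ D.chart.toChart.source := by
  rw [closedRegion_eq]
  rintro _ ⟨z, hz, rfl⟩
  exact D.chart.toChart.map_target (D.rect_subset hz)

lemma coord_mem {x : X} (hx : x ∈ D.closedRegion) :
    D.chart.toChart x ∈ Icc D.u₀ D.u₁ ×ˢ Icc D.v₀ D.v₁ := by
  rw [closedRegion_eq] at hx
  obtain ⟨z, hz, rfl⟩ := hx
  rwa [D.chart.toChart.right_inv (D.rect_subset hz)]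

lemma symm_mem {z : ℝ × ℝ} (hz : z ∈ Icc D.u₀ D.u₁ ×ˢ Icc D.v₀ D.v₁) :
    D.chart.toChart.symm z ∈ D.closedRegion := by
  rw [closedRegion_eq]
  exact ⟨z, hz, rfl⟩

lemma symm_coord {x : X} (hx : x ∈ D.closedRegion) :
    D.chart.toChart.symm (D.chart.toChart x) = x :=
  D.chart.toChart.left_inv (D.closedRegion_subset_source hx)

lemma closedRegion_subset_Y : D.closedRegion ⊆ D.Y := fun _ h ↦ CausalLE.mem D.p_mem h.1

/-- In the closed diamond, causally related points have ordered coordinates. -/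
lemma coord_le {a b : X} (h : M.CausalLE D.Y a b) (ha : M.CausalLE D.Y D.p a)
    (hb : M.CausalLE D.Y b D.q) : D.chart.toChart a ≤ D.chart.toChart b := by
  induction h using Relation.ReflTransGen.head_induction_on with
  | refl => exact le_rfl
  | head hac hcb ih =>
    refine le_trans ?_ (ih (ha.tail hac))
    obtain ⟨γ, s, t, hst, h1, h2, hc, h⟩ := hac
    have hs : ∀ r ∈ Icc s t, γ r ∈ D.chart.toChart.source := fun r hr ↦ by
      obtain ⟨h3, h4⟩ := CausalStep.sub h1 h2 hc h hr
      exact D.closedRegion_subset_source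
        ⟨Relation.ReflTransGen.trans ha h3, (Relation.ReflTransGen.trans h4 hcb).trans hb⟩
    have := D.chart.coord_le hst.le hs fun r hr ↦ (h r hr).2
    rwa [h1, h2] at this

/-- In the closed diamond, points with ordered coordinates are causally related. -/
lemma causalLE_of_le {z z' : ℝ × ℝ} (hz : z ∈ Icc D.u₀ D.u₁ ×ˢ Icc D.v₀ D.v₁)
    (hz' : z' ∈ Icc D.u₀ D.u₁ ×ˢ Icc D.v₀ D.v₁) (h : z ≤ z') :
    M.CausalLE D.Y (D.chart.toChart.symm z) (D.chart.toChart.symm z') := by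
  rcases eq_or_ne z z' with rfl | hne
  · exact .refl
  have hmem : ∀ t ∈ Icc (0 : ℝ) 1, z + t • (z' - z) ∈ Icc D.u₀ D.u₁ ×ˢ Icc D.v₀ D.v₁ := by
    intro t ht
    exact ((convex_Icc _ _).prod (convex_Icc _ _)).add_smul_sub_mem hz hz' ht
  have hd : ∀ t, HasDerivAt (fun t : ℝ ↦ z + t • (z' - z)) (z' - z) t := fun t ↦ by
    simpa using ((hasDerivAt_id t).smul_const (z' - z)).const_add z
  refine .single ⟨fun t ↦ D.chart.toChart.symm (z + t • (z' - z)), 0, 1, zero_lt_one, by simp,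
    by simp, D.chart.curve_contMDiffOn (c := fun t ↦ z + t • (z' - z)) (by fun_prop)
      (fun t ht ↦ D.rect_subset (hmem t ht)),
    fun t ht ↦ ⟨D.closedRegion_subset_Y (D.symm_mem (hmem t ht)), _,
      D.chart.curve_hasVelocity (hd t) (D.rect_subset (hmem t ht)),
      D.chart.futureCausal_frame (D.rect_subset (hmem t ht)) ?_ ?_ ?_⟩⟩
  · exact sub_nonneg.mpr h.1
  · exact sub_nonneg.mpr h.2
  · exact sub_ne_zero.mpr hne.symm

/-- A smaller coordinate rectangle is again a causal diamond. -/
def sub {u₀ u₁ v₀ v₁ : ℝ} (h₁ : D.u₀ ≤ u₀) (hu : u₀ < u₁) (h₂ : u₁ ≤ D.u₁)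
    (h₃ : D.v₀ ≤ v₀) (hv : v₀ < v₁) (h₄ : v₁ ≤ D.v₁) : CausalDiamond M where
  Y := D.Y
  hyperbolic := D.hyperbolic
  p := D.chart.toChart.symm (u₀, v₀)
  q := D.chart.toChart.symm (u₁, v₁)
  p_mem := D.closedRegion_subset_Y (D.symm_mem
    ⟨⟨h₁, hu.le.trans h₂⟩, ⟨h₃, hv.le.trans h₄⟩⟩)
  q_mem := D.closedRegion_subset_Y (D.symm_mem
    ⟨⟨h₁.trans hu.le, h₂⟩, ⟨h₃.trans hv.le, h₄⟩⟩)
  chart := D.chart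
  u₀ := u₀
  u₁ := u₁
  v₀ := v₀
  v₁ := v₁
  u_lt := hu
  v_lt := hv
  rect_subset := (prod_mono (Icc_subset_Icc h₁ h₂) (Icc_subset_Icc h₃ h₄)).trans D.rect_subset
  p_eq := rfl
  q_eq := rfl
  inter_eq := by
    have hsub : Icc u₀ u₁ ×ˢ Icc v₀ v₁ ⊆ Icc D.u₀ D.u₁ ×ˢ Icc D.v₀ D.v₁ :=
      prod_mono (Icc_subset_Icc h₁ h₂) (Icc_subset_Icc h₃ h₄)
    have hp : (u₀, v₀) ∈ Icc u₀ u₁ ×ˢ Icc v₀ v₁ := ⟨⟨le_rfl, hu.le⟩, ⟨le_rfl, hv.le⟩⟩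
    have hq : (u₁, v₁) ∈ Icc u₀ u₁ ×ˢ Icc v₀ v₁ := ⟨⟨hu.le, le_rfl⟩, ⟨hv.le, le_rfl⟩⟩
    have hp' := D.symm_mem (hsub hp)
    have hq' := D.symm_mem (hsub hq)
    apply Subset.antisymm
    · rintro r ⟨h5, h6⟩
      have hr : r ∈ D.closedRegion :=
        ⟨Relation.ReflTransGen.trans hp'.1 h5, Relation.ReflTransGen.trans h6 hq'.2⟩
      have h7 := D.coord_le h5 hp'.1 hr.2
      have h8 := D.coord_le h6 hr.1 hq'.2
      rw [D.chart.toChart.right_inv (D.rect_subset (hsub hp))] at h7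
      rw [D.chart.toChart.right_inv (D.rect_subset (hsub hq))] at h8
      exact ⟨_, ⟨⟨h7.1, h8.1⟩, ⟨h7.2, h8.2⟩⟩, D.symm_coord hr⟩
    · rintro _ ⟨z, hz, rfl⟩
      exact ⟨D.causalLE_of_le (hsub hp) (hsub hz) ⟨hz.1.1, hz.2.1⟩,
        D.causalLE_of_le (hsub hz) (hsub hq) ⟨hz.1.2, hz.2.2⟩⟩

/-! ### Paths in a diamond -/

lemma up_self {u v : ℝ} (h₁ : D.u₀ ≤ u) (h : u ≤ u) (h₂ : u ≤ D.u₁) (hv₀ : D.v₀ ≤ v)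
    (hv₁ : v ≤ D.v₁) {x : X} (hx hy : D.chart.toChart.symm (u, v) = x) :
    D.up h₁ h h₂ hv₀ hv₁ hx hy = 𝟙 _ :=
  Segment.path_const _ rfl

lemma down_self {u v : ℝ} (h₁ : v ≤ D.v₁) (h : v ≤ v) (h₂ : D.v₀ ≤ v) (hu₀ : D.u₀ ≤ u)
    (hu₁ : u ≤ D.u₁) {x : X} (hx hy : D.chart.toChart.symm (u, v) = x) :
    D.down h₁ h h₂ hu₀ hu₁ hx hy = 𝟙 _ :=
  Segment.path_const _ rfl

lemma up_comp_up {u₁ u₂ u₃ v : ℝ} (h₁ : D.u₀ ≤ u₁) (h : u₁ ≤ u₂) (h₂ : u₂ ≤ D.u₁)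
    (h₂' : D.u₀ ≤ u₂) (h' : u₂ ≤ u₃) (h₃ : u₃ ≤ D.u₁) (hv₀ : D.v₀ ≤ v) (hv₁ : v ≤ D.v₁)
    {x y z : X} (hx : D.chart.toChart.symm (u₁, v) = x)
    (hy : D.chart.toChart.symm (u₂, v) = y) (hz : D.chart.toChart.symm (u₃, v) = z) :
    D.up h₁ h h₂ hv₀ hv₁ hx hy ≫ D.up h₂' h' h₃ hv₀ hv₁ hy hz =
      D.up h₁ (h.trans h') h₃ hv₀ hv₁ hx hz := by
  unfold up
  symm
  apply Segment.path_cut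
  exacts [rfl, rfl, rfl, fun _ _ ↦ rfl, fun _ _ ↦ rfl]

lemma down_comp_down {u v₁ v₂ v₃ : ℝ} (h₁ : v₁ ≤ D.v₁) (h : v₂ ≤ v₁) (h₂ : D.v₀ ≤ v₂)
    (h₂' : v₂ ≤ D.v₁) (h' : v₃ ≤ v₂) (h₃ : D.v₀ ≤ v₃) (hu₀ : D.u₀ ≤ u) (hu₁ : u ≤ D.u₁)
    {x y z : X} (hx : D.chart.toChart.symm (u, v₁) = x)
    (hy : D.chart.toChart.symm (u, v₂) = y) (hz : D.chart.toChart.symm (u, v₃) = z) :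
    D.down h₁ h h₂ hu₀ hu₁ hx hy ≫ D.down h₂' h' h₃ hu₀ hu₁ hy hz =
      D.down h₁ (h'.trans h) h₃ hu₀ hu₁ hx hz := by
  unfold down
  symm
  apply Segment.path_cut
  exacts [rfl, rfl, rfl, fun _ _ ↦ rfl, fun _ _ ↦ rfl]

/-- A coordinate rectangle in the closed diamond gives a 2-morphism. -/
lemma sweep_rect {u₀ u₁ v₀ v₁ : ℝ} (h₁ : D.u₀ ≤ u₀) (hu : u₀ ≤ u₁) (h₂ : u₁ ≤ D.u₁)
    (h₃ : D.v₀ ≤ v₀) (hv : v₀ ≤ v₁) (h₄ : v₁ ≤ D.v₁) {x y p q : X}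
    (hx : D.chart.toChart.symm (u₀, v₁) = x) (hq : D.chart.toChart.symm (u₁, v₁) = q)
    (hp : D.chart.toChart.symm (u₀, v₀) = p) (hy : D.chart.toChart.symm (u₁, v₀) = y) :
    Sweep (D.up h₁ hu h₂ (h₃.trans hv) h₄ hx hq ≫ D.down h₄ hv h₃ (h₁.trans hu) h₂ hq hy)
      (D.down h₄ hv h₃ h₁ (hu.trans h₂) hx hp ≫ D.up h₁ hu h₂ h₃ (hv.trans h₄) hp hy) := by
  subst hx hy hp hq
  rcases hu.eq_or_lt with rfl | hu'
  · rw [up_self, up_self, Category.id_comp, Category.comp_id]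
    exact .refl _
  rcases hv.eq_or_lt with rfl | hv'
  · rw [down_self, down_self, Category.id_comp, Category.comp_id]
    exact .refl _
  have := Sweep.diamond (D.sub h₁ hu' h₂ h₃ hv' h₄) (𝟙 _) (𝟙 _)
  simp only [Category.id_comp, Category.comp_id] at this
  exact this

end CausalDiamond

namespace CausalDiamond

variable (D : CausalDiamond M)

/-- The path from the left corner of the diamond to a point `x` of the closed diamond: down along
the past boundary to the lightlike projection of `x`, then up to `x`. -/
def fromLeft {x : X} (hx : x ∈ D.closedRegion) : (⟨D.left⟩ : PathTwoCat M) ⟶ ⟨x⟩ :=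
  D.down (u := D.u₀) le_rfl (D.coord_mem hx).2.2 (D.coord_mem hx).2.1 le_rfl D.u_lt.le D.left_eq
      rfl ≫
    D.up le_rfl (D.coord_mem hx).1.1 (D.coord_mem hx).1.2 (D.coord_mem hx).2.1
      (D.coord_mem hx).2.2 rfl (D.symm_coord hx)

/-- The path from a point `x` of the closed diamond to the right corner: down to the lightlike
projection of `x` to the past boundary, then up along the past boundary. -/
def toRight {x : X} (hx : x ∈ D.closedRegion) : (⟨x⟩ : PathTwoCat M) ⟶ ⟨D.right⟩ :=
  D.down (D.coord_mem hx).2.2 (D.coord_mem hx).2.1 le_rfl (D.coord_mem hx).1.1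
      (D.coord_mem hx).1.2 (D.symm_coord hx) rfl ≫
    D.up (v := D.v₀) (D.coord_mem hx).1.1 (D.coord_mem hx).1.2 le_rfl le_rfl D.v_lt.le rfl
      D.right_eq

lemma left_mem : D.left ∈ D.closedRegion :=
  D.symm_mem ⟨⟨le_rfl, D.u_lt.le⟩, ⟨D.v_lt.le, le_rfl⟩⟩

lemma right_mem : D.right ∈ D.closedRegion :=
  D.symm_mem ⟨⟨D.u_lt.le, le_rfl⟩, ⟨le_rfl, D.v_lt.le⟩⟩

lemma p_mem_closedRegion : D.p ∈ D.closedRegion := by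
  rw [← D.p_eq]
  exact D.symm_mem ⟨⟨le_rfl, D.u_lt.le⟩, ⟨le_rfl, D.v_lt.le⟩⟩

lemma isCompact_closedRegion : IsCompact D.closedRegion :=
  D.hyperbolic.isCompact _ D.p_mem _ D.q_mem

variable {D} {D' : CausalDiamond M}

/-- If the open diamonds are nested, so are the closed ones. -/
lemma closedRegion_mono [T2Space X] (h : D'.region ⊆ D.region) :
    D'.closedRegion ⊆ D.closedRegion := by
  have h1 : D'.chart.toChart.symm '' (Ioo D'.u₀ D'.u₁ ×ˢ Ioo D'.v₀ D'.v₁) ⊆ D'.region := by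
    refine interior_maximal ?_ ?_
    · rw [D'.inter_eq]
      exact image_mono (Set.prod_mono Ioo_subset_Icc_self Ioo_subset_Icc_self)
    · exact D'.chart.toChart.isOpen_image_symm_of_subset_target (isOpen_Ioo.prod isOpen_Ioo)
        ((Set.prod_mono Ioo_subset_Icc_self Ioo_subset_Icc_self).trans D'.rect_subset)
  have h2 : D'.region ⊆ D.closedRegion := h.trans interior_subset
  have h3 : closure D'.region ⊆ D.closedRegion :=
    closure_minimal h2 D.isCompact_closedRegion.isClosed
  refine Subset.trans ?_ h3
  rw [closedRegion_eq]
  have h4 : closure (Ioo D'.u₀ D'.u₁ ×ˢ Ioo D'.v₀ D'.v₁) = Icc D'.u₀ D'.u₁ ×ˢ Icc D'.v₀ D'.v₁ := by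
    rw [closure_prod_eq, closure_Ioo D'.u_lt.ne, closure_Ioo D'.v_lt.ne]
  have h5 : ContinuousOn D'.chart.toChart.symm (closure (Ioo D'.u₀ D'.u₁ ×ˢ Ioo D'.v₀ D'.v₁)) := by
    rw [h4]
    exact D'.chart.toChart.continuousOn_symm.mono D'.rect_subset
  rw [← h4]
  exact h5.image_closure.trans (closure_mono h1)

/-- Change of null coordinates along a coordinate line of `u`. -/
lemma coord_up (hD : D'.closedRegion ⊆ D.closedRegion) {v : ℝ} (hv : v ∈ Icc D'.v₀ D'.v₁) :
    ContinuousOn (fun u ↦ (D.chart.toChart (D'.chart.toChart.symm (u, v))).1)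
        (Icc D'.u₀ D'.u₁) ∧
      StrictMonoOn (fun u ↦ (D.chart.toChart (D'.chart.toChart.symm (u, v))).1)
        (Icc D'.u₀ D'.u₁) ∧
      ∀ u ∈ Icc D'.u₀ D'.u₁, (D.chart.toChart (D'.chart.toChart.symm (u, v))).2 =
        (D.chart.toChart (D'.chart.toChart.symm (D'.u₀, v))).2 := by
  have key : ∀ u ∈ Icc D'.u₀ D'.u₁, ∃ d : ℝ × ℝ,
      (∀ s, HasDerivWithinAt (fun u ↦ D.chart.toChart (D'.chart.toChart.symm (u, v))) d s u) ∧
        0 < d.1 ∧ d.2 = 0 := by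
    intro u hu
    have ht := D'.mem_target hu hv
    have hs := D.closedRegion_subset_source (hD (D'.symm_mem (z := (u, v)) ⟨hu, hv⟩))
    have hd : HasDerivAt (fun t : ℝ ↦ (t, v)) (1, 0) u :=
      (hasDerivAt_id u).prodMk (hasDerivAt_const u v)
    exact ⟨_, fun s ↦ D.chart.hasDerivWithinAt_coord (D'.chart.curve_hasVelocity hd ht) hs,
      D.chart.coframe_right hs (D'.chart.du_future _ ht) (D'.chart.du_lightlike _ ht)
        (D'.chart.du_right _ ht)⟩
  choose! d hd hd1 hd2 using key
  have hin : interior (Icc D'.u₀ D'.u₁) ⊆ Icc D'.u₀ D'.u₁ := interior_subset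
  have hc : ContinuousOn (fun u ↦ (D.chart.toChart (D'.chart.toChart.symm (u, v))).1)
      (Icc D'.u₀ D'.u₁) :=
    fun u hu ↦ (NullChart.hasDerivWithinAt_fst (hd u hu _)).continuousWithinAt
  refine ⟨hc, ?_, ?_⟩
  · exact strictMonoOn_of_hasDerivWithinAt_pos (f' := fun u ↦ (d u).1) (convex_Icc _ _) hc
      (fun u hu ↦ NullChart.hasDerivWithinAt_fst (hd u (hin hu) _)) (fun u hu ↦ hd1 u (hin hu))
  · exact constant_of_has_deriv_right_zero
      (fun u hu ↦ (NullChart.hasDerivWithinAt_snd (hd u hu _)).continuousWithinAt)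
      (fun u hu ↦ by
        have hu' : u ∈ Icc D'.u₀ D'.u₁ := ⟨hu.1, hu.2.le⟩
        have := NullChart.hasDerivWithinAt_snd (hd u hu' (Ici u))
        rwa [hd2 u hu'] at this)

/-- Change of null coordinates along a coordinate line of `v`. -/
lemma coord_down (hD : D'.closedRegion ⊆ D.closedRegion) {u : ℝ} (hu : u ∈ Icc D'.u₀ D'.u₁) :
    ContinuousOn (fun v ↦ (D.chart.toChart (D'.chart.toChart.symm (u, v))).2)
        (Icc D'.v₀ D'.v₁) ∧
      StrictMonoOn (fun v ↦ (D.chart.toChart (D'.chart.toChart.symm (u, v))).2)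
        (Icc D'.v₀ D'.v₁) ∧
      ∀ v ∈ Icc D'.v₀ D'.v₁, (D.chart.toChart (D'.chart.toChart.symm (u, v))).1 =
        (D.chart.toChart (D'.chart.toChart.symm (u, D'.v₀))).1 := by
  have key : ∀ v ∈ Icc D'.v₀ D'.v₁, ∃ d : ℝ × ℝ,
      (∀ s, HasDerivWithinAt (fun v ↦ D.chart.toChart (D'.chart.toChart.symm (u, v))) d s v) ∧
        d.1 = 0 ∧ 0 < d.2 := by
    intro v hv
    have ht := D'.mem_target hu hv
    have hs := D.closedRegion_subset_source (hD (D'.symm_mem (z := (u, v)) ⟨hu, hv⟩))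
    have hd : HasDerivAt (fun t : ℝ ↦ (u, t)) (0, 1) v :=
      (hasDerivAt_const v u).prodMk (hasDerivAt_id v)
    exact ⟨_, fun s ↦ D.chart.hasDerivWithinAt_coord (D'.chart.curve_hasVelocity hd ht) hs,
      D.chart.coframe_left hs (D'.chart.dv_future _ ht) (D'.chart.dv_lightlike _ ht)
        (D'.chart.dv_left _ ht)⟩
  choose! d hd hd1 hd2 using key
  have hin : interior (Icc D'.v₀ D'.v₁) ⊆ Icc D'.v₀ D'.v₁ := interior_subset
  have hc : ContinuousOn (fun v ↦ (D.chart.toChart (D'.chart.toChart.symm (u, v))).2)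
      (Icc D'.v₀ D'.v₁) :=
    fun v hv ↦ (NullChart.hasDerivWithinAt_snd (hd v hv _)).continuousWithinAt
  refine ⟨hc, ?_, ?_⟩
  · exact strictMonoOn_of_hasDerivWithinAt_pos (f' := fun v ↦ (d v).2) (convex_Icc _ _) hc
      (fun v hv ↦ NullChart.hasDerivWithinAt_snd (hd v (hin hv) _)) (fun v hv ↦ hd2 v (hin hv))
  · exact constant_of_has_deriv_right_zero
      (fun v hv ↦ (NullChart.hasDerivWithinAt_fst (hd v hv _)).continuousWithinAt)
      (fun v hv ↦ by
        have hv' : v ∈ Icc D'.v₀ D'.v₁ := ⟨hv.1, hv.2.le⟩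
        have := NullChart.hasDerivWithinAt_fst (hd v hv' (Ici v))
        rwa [hd1 v hv'] at this)

lemma coord_symm {u v : ℝ} (hu₀ : D.u₀ ≤ u) (hu₁ : u ≤ D.u₁) (hv₀ : D.v₀ ≤ v) (hv₁ : v ≤ D.v₁) :
    D.chart.toChart (D.chart.toChart.symm (u, v)) = (u, v) :=
  D.chart.toChart.right_inv (D.mem_target ⟨hu₀, hu₁⟩ ⟨hv₀, hv₁⟩)

/-- The path along a coordinate line of `u` does not depend on the null coordinates. -/
lemma up_eq_up (hD : D'.closedRegion ⊆ D.closedRegion) {u₁ u₂ v a₁ a₂ b : ℝ} {x y : X}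
    (h₁ : D'.u₀ ≤ u₁) (h : u₁ ≤ u₂) (h₂ : u₂ ≤ D'.u₁) (hv₀ : D'.v₀ ≤ v) (hv₁ : v ≤ D'.v₁)
    (hx : D'.chart.toChart.symm (u₁, v) = x) (hy : D'.chart.toChart.symm (u₂, v) = y)
    (k₁ : D.u₀ ≤ a₁) (k : a₁ ≤ a₂) (k₂ : a₂ ≤ D.u₁) (hb₀ : D.v₀ ≤ b) (hb₁ : b ≤ D.v₁)
    (hx' : D.chart.toChart.symm (a₁, b) = x) (hy' : D.chart.toChart.symm (a₂, b) = y) :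
    D'.up h₁ h h₂ hv₀ hv₁ hx hy = D.up k₁ k k₂ hb₀ hb₁ hx' hy' := by
  obtain ⟨hc, hm, he⟩ := coord_up hD (v := v) ⟨hv₀, hv₁⟩
  have hsub : Icc u₁ u₂ ⊆ Icc D'.u₀ D'.u₁ := Icc_subset_Icc h₁ h₂
  have e₁ : D.chart.toChart (D'.chart.toChart.symm (u₁, v)) = (a₁, b) := by
    rw [hx, ← hx', coord_symm k₁ (k.trans k₂) hb₀ hb₁]
  have e₂ : D.chart.toChart (D'.chart.toChart.symm (u₂, v)) = (a₂, b) := by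
    rw [hy, ← hy', coord_symm (k₁.trans k) k₂ hb₀ hb₁]
  refine Segment.path_reparam _ _
    (fun u ↦ (D.chart.toChart (D'.chart.toChart.symm (u, v))).1) (hc.mono hsub) (hm.mono hsub)
    (congrArg Prod.fst e₁) (congrArg Prod.fst e₂) fun t ht ↦ ?_
  have h3 : (D.chart.toChart (D'.chart.toChart.symm (t, v))).2 = b := by
    rw [he t (hsub ht), ← he u₁ (hsub ⟨le_rfl, h⟩), e₁]
  change D'.chart.toChart.symm (t, v) =
    D.chart.toChart.symm ((D.chart.toChart (D'.chart.toChart.symm (t, v))).1, b)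
  have h4 := D.symm_coord (hD (D'.symm_mem (z := (t, v)) ⟨hsub ht, ⟨hv₀, hv₁⟩⟩))
  rw [← h3]
  exact h4.symm

/-- The path along a coordinate line of `v` does not depend on the null coordinates. -/
lemma down_eq_down (hD : D'.closedRegion ⊆ D.closedRegion) {u v₁ v₂ a b₁ b₂ : ℝ} {x y : X}
    (h₁ : v₁ ≤ D'.v₁) (h : v₂ ≤ v₁) (h₂ : D'.v₀ ≤ v₂) (hu₀ : D'.u₀ ≤ u) (hu₁ : u ≤ D'.u₁)
    (hx : D'.chart.toChart.symm (u, v₁) = x) (hy : D'.chart.toChart.symm (u, v₂) = y)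
    (k₁ : b₁ ≤ D.v₁) (k : b₂ ≤ b₁) (k₂ : D.v₀ ≤ b₂) (ha₀ : D.u₀ ≤ a) (ha₁ : a ≤ D.u₁)
    (hx' : D.chart.toChart.symm (a, b₁) = x) (hy' : D.chart.toChart.symm (a, b₂) = y) :
    D'.down h₁ h h₂ hu₀ hu₁ hx hy = D.down k₁ k k₂ ha₀ ha₁ hx' hy' := by
  obtain ⟨hc, hm, he⟩ := coord_down hD (u := u) ⟨hu₀, hu₁⟩
  have hneg : MapsTo (fun t : ℝ ↦ -t) (Icc (-v₁) (-v₂)) (Icc D'.v₀ D'.v₁) :=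
    fun t ht ↦ ⟨by linarith [ht.2], by linarith [ht.1]⟩
  have e₁ : D.chart.toChart (D'.chart.toChart.symm (u, v₁)) = (a, b₁) := by
    rw [hx, ← hx', coord_symm ha₀ ha₁ (k₂.trans k) k₁]
  have e₂ : D.chart.toChart (D'.chart.toChart.symm (u, v₂)) = (a, b₂) := by
    rw [hy, ← hy', coord_symm ha₀ ha₁ k₂ (k.trans k₁)]
  refine Segment.path_reparam _ _
    (fun t ↦ -(D.chart.toChart (D'.chart.toChart.symm (u, -t))).2)
    ((hc.comp continuous_neg.continuousOn hneg).neg) ?_ ?_ ?_ fun t ht ↦ ?_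
  · intro s hs t ht hst
    exact neg_lt_neg (hm (hneg ht) (hneg hs) (neg_lt_neg hst))
  · change -(D.chart.toChart (D'.chart.toChart.symm (u, - -v₁))).2 = -b₁
    rw [neg_neg, e₁]
  · change -(D.chart.toChart (D'.chart.toChart.symm (u, - -v₂))).2 = -b₂
    rw [neg_neg, e₂]
  have h3 : (D.chart.toChart (D'.chart.toChart.symm (u, -t))).1 = a := by
    rw [he (-t) (hneg ht), ← he v₁ ⟨h₂.trans h, h₁⟩, e₁]
  change D'.chart.toChart.symm (u, -t) =
    D.chart.toChart.symm (a, - -(D.chart.toChart (D'.chart.toChart.symm (u, -t))).2)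
  have h4 := D.symm_coord (hD (D'.symm_mem (z := (u, -t)) ⟨⟨hu₀, hu₁⟩, hneg ht⟩))
  rw [neg_neg, ← h3]
  exact h4.symm

/-- The 2-morphism `f'` of an inclusion of diamonds. -/
lemma sweep_inclusion (hD : D'.closedRegion ⊆ D.closedRegion) :
    Sweep (D.fromLeft (hD D'.left_mem) ≫ D'.pastBoundary ≫ D.toRight (hD D'.right_mem))
      D.pastBoundary := by
  have ml := hD D'.left_mem
  have mp := hD D'.p_mem_closedRegion
  have mr := hD D'.right_mem
  have cl := D.coord_mem ml
  have cp := D.coord_mem mp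
  have cr := D.coord_mem mr
  have sl := D.symm_coord ml
  have sp := D.symm_coord mp
  have sr := D.symm_coord mr
  have e1 : (D.chart.toChart D'.left).1 = (D.chart.toChart D'.p).1 := by
    rw [← D'.p_eq]
    exact (coord_down hD (u := D'.u₀) ⟨le_rfl, D'.u_lt.le⟩).2.2 _ ⟨D'.v_lt.le, le_rfl⟩
  have l1 : (D.chart.toChart D'.p).2 ≤ (D.chart.toChart D'.left).2 := by
    rw [← D'.p_eq]
    exact (coord_down hD (u := D'.u₀) ⟨le_rfl, D'.u_lt.le⟩).2.1.monotoneOn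
      ⟨le_rfl, D'.v_lt.le⟩ ⟨D'.v_lt.le, le_rfl⟩ D'.v_lt.le
  have e2 : (D.chart.toChart D'.right).2 = (D.chart.toChart D'.p).2 := by
    rw [← D'.p_eq]
    exact (coord_up hD (v := D'.v₀) ⟨le_rfl, D'.v_lt.le⟩).2.2 _ ⟨D'.u_lt.le, le_rfl⟩
  have l2 : (D.chart.toChart D'.p).1 ≤ (D.chart.toChart D'.right).1 := by
    rw [← D'.p_eq]
    exact (coord_up hD (v := D'.v₀) ⟨le_rfl, D'.v_lt.le⟩).2.1.monotoneOn
      ⟨le_rfl, D'.u_lt.le⟩ ⟨D'.u_lt.le, le_rfl⟩ D'.u_lt.le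
  unfold fromLeft toRight
  generalize_proofs
  generalize hcl : D.chart.toChart D'.left = zl at *
  generalize hcp : D.chart.toChart D'.p = zp at *
  generalize hcr : D.chart.toChart D'.right = zr at *
  obtain ⟨a₁, b₂⟩ := zl
  obtain ⟨a₁', b₁⟩ := zp
  obtain ⟨a₂, b₁'⟩ := zr
  obtain rfl : a₁ = a₁' := e1
  obtain rfl : b₁' = b₁ := e2
  obtain ⟨⟨cl1, cl2⟩, ⟨cl3, cl4⟩⟩ := cl
  obtain ⟨⟨cp1, cp2⟩, ⟨cp3, cp4⟩⟩ := cp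
  obtain ⟨⟨cr1, cr2⟩, ⟨cr3, cr4⟩⟩ := cr
  dsimp only at *
  have hpast : D'.pastBoundary = D.down cl4 l1 cp3 cl1 cl2 sl sp ≫
      D.up cl1 l2 cr2 cp3 cp4 sp sr := by
    unfold pastBoundary
    rw [down_eq_down hD _ _ _ _ _ _ _ cl4 l1 cp3 cl1 cl2 sl sp,
      up_eq_up hD _ _ _ _ _ _ _ cl1 l2 cr2 cp3 cp4 sp sr]
  rw [hpast]
  have s1 := D.sweep_rect le_rfl cl1 cl2 cp3 l1 cl4 rfl sl rfl sp
  have s2 := D.sweep_rect le_rfl cr1 cr2 le_rfl cp3 cp4 rfl sr D.p_eq rfl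
  have t1 := Sweep.whiskerLeft
    (D.down (u := D.u₀) le_rfl cl4 cl3 le_rfl D.u_lt.le D.left_eq rfl)
    (s1.whiskerRight (D.up cl1 l2 cr2 cp3 cp4 sp sr ≫
      D.down cp4 cp3 le_rfl cr1 cr2 sr rfl ≫
      D.up (v := D.v₀) cr1 cr2 le_rfl le_rfl D.v_lt.le rfl D.right_eq))
  have t2 := Sweep.whiskerLeft
    (D.down (u := D.u₀) le_rfl cp4 cp3 le_rfl D.u_lt.le D.left_eq rfl)
    (s2.whiskerRight (D.up (v := D.v₀) cr1 cr2 le_rfl le_rfl D.v_lt.le rfl D.right_eq))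
  simp only [Category.assoc] at t1 t2 ⊢
  refine t1.trans ?_
  rw [← Category.assoc (D.up _ _ _ _ _ _ _) (D.up _ _ _ _ _ _ _), up_comp_up,
    ← Category.assoc (D.down _ _ _ _ _ _ _) (D.down _ _ _ _ _ _ _), down_comp_down]
  refine t2.trans ?_
  rw [up_comp_up, ← Category.assoc, down_comp_down]
  exact .refl _

end CausalDiamond

/-! ### Nets of monoids on causal subsets -/

variable (M) in
/-- The causal subsets of (the open subset) `W` of `X`: the interiors of causal diamonds in globally
hyperbolic subsets of `W`. -/
@[ext]
structure CausalSubset (W : Set X) where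
  carrier : Set X
  exists_diamond : ∃ D : CausalDiamond M, D.Y ⊆ W ∧ D.region = carrier

/-- Causal subsets are ordered by inclusion. -/
instance (W : Set X) : PartialOrder (CausalSubset M W) :=
  PartialOrder.lift CausalSubset.carrier fun _ _ ↦ CausalSubset.ext

namespace CausalSubset

/-- A causal subset of `W`, as a causal subset of `X`. -/
def toUniv {W : Set X} (O : CausalSubset M W) : CausalSubset M univ where
  carrier := O.carrier
  exists_diamond := O.exists_diamond.imp fun _ h ↦ ⟨subset_univ _, h.2⟩

/-- A diamond whose interior is the causal subset `O`. Its closed rectangle is the closure of `O`, and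
lightlike segments do not depend on the null coordinates (`up_eq_up`, `down_eq_down`), so the corners
and the boundary paths only depend on `O`. -/
def diamond {W : Set X} (O : CausalSubset M W) : CausalDiamond M := O.exists_diamond.choose

lemma diamond_region {W : Set X} (O : CausalSubset M W) : O.diamond.region = O.carrier :=
  O.exists_diamond.choose_spec.2

lemma closedRegion_mono [T2Space X] {W : Set X} {O' O : CausalSubset M W} (h : O' ≤ O) :
    O'.diamond.closedRegion ⊆ O.diamond.closedRegion :=
  CausalDiamond.closedRegion_mono (by rw [diamond_region, diamond_region]; exact h)

end CausalSubset

variable (M) in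
/-- An assignment of monoids to the causal subsets of `W` and of homomorphisms to the inclusions. -/
structure PreNet (W : Set X) where
  obj : CausalSubset M W → Type w
  [monoid : ∀ O, Monoid (obj O)]
  map : ∀ {O' O : CausalSubset M W}, O' ≤ O → (obj O' →* obj O)

attribute [instance] PreNet.monoid

namespace PreNet

/-- The restriction to the causal subsets of `Y`. -/
def restrict (A : PreNet.{u, w} M univ) (Y : Set X) : PreNet.{u, w} M Y where
  obj O := A.obj O.toUniv
  map h := A.map (O' := CausalSubset.toUniv _) (O := CausalSubset.toUniv _) h

variable {W : Set X} (A : PreNet.{u, w} M W)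

/-- A net of monoids: a functor that sends all inclusions to injections. -/
structure IsNet : Prop where
  map_id (O : CausalSubset M W) : A.map (le_refl O) = MonoidHom.id _
  map_comp {O'' O' O : CausalSubset M W} (h' : O'' ≤ O') (h : O' ≤ O) :
    A.map (h'.trans h) = (A.map h).comp (A.map h')
  injective {O' O : CausalSubset M W} (h : O' ≤ O) : Function.Injective (A.map h)

/-- A net of local monoids: the monoids of two causal subsets of `O` that are spacelike separated
commute in the monoid of `O`. -/
structure IsLocalNet : Prop extends A.IsNet where
  commute {O₁ O₂ O : CausalSubset M W} (h₁ : O₁ ≤ O) (h₂ : O₂ ≤ O)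
    (hs : M.SpacelikeSeparated W O₁.carrier O₂.carrier) (a₁ : A.obj O₁) (a₂ : A.obj O₂) :
    Commute (A.map h₁ a₁) (A.map h₂ a₂)

/-- The time slice axiom: if a collection of causal subsets of `O` covers a Cauchy surface of `O`,
then the union of their monoids in the monoid of `O` is everything. -/
def TimeSlice : Prop :=
  ∀ (O : CausalSubset M W) (Sig : Set X), M.IsCauchySurface O.carrier Sig →
    ∀ (𝒰 : Set (CausalSubset M W)) (h : ∀ U ∈ 𝒰, U ≤ O), Sig ⊆ ⋃ U ∈ 𝒰, U.carrier →
      ⋃ (U) (hU : U ∈ 𝒰), range (A.map (h U hU)) = univ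

end PreNet

/-! ### The net of a 2-functor -/

section NetOfFunctor

variable {C : Type u₁} [Bicategory.{w₁, v₁} C]

variable (C) in
/-- All 1-morphisms are invertible up to 2-isomorphism. A bicategory with this property in which
all 2-morphisms are invertible is a 2-groupoid. -/
def OneMorphismsInvertible : Prop :=
  ∀ {a b : C} (f : a ⟶ b), ∃ g : b ⟶ a, Nonempty (f ≫ g ≅ 𝟙 a) ∧ Nonempty (g ≫ f ≅ 𝟙 b)

/-- Horizontal composition with the images of the 1-morphisms under `Z` is injective on
2-morphisms. -/
def HorizontallyInjective (Z : Pseudofunctor (PathTwoCat M) C) : Prop :=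
  ∀ {x y : PathTwoCat M} (f : x ⟶ y) (c : C),
    (∀ g h : Z.obj y ⟶ c, Function.Injective (fun η : g ⟶ h ↦ Z.map f ◁ η)) ∧
    (∀ g h : c ⟶ Z.obj x, Function.Injective (fun η : g ⟶ h ↦ η ▷ Z.map f))

variable [Bicategory.IsLocallyGroupoid C] (Z : Pseudofunctor (PathTwoCat M) C)
  {D D' : CausalDiamond M} (hD : D'.closedRegion ⊆ D.closedRegion)

/-- The image under `Z` of the 2-morphism of an inclusion of diamonds. Its source is the past
boundary of the smaller diamond, extended on both sides by the lightlike projections of its corners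
to the past boundary of the larger one, its target is the past boundary of the larger diamond. -/
def inclusionIso : Z.map (D.fromLeft (hD D'.left_mem)) ≫ Z.map D'.pastBoundary ≫
    Z.map (D.toRight (hD D'.right_mem)) ≅ Z.map D.pastBoundary :=
  Bicategory.whiskerLeftIso _ (Z.mapComp _ _).symm ≪≫ (Z.mapComp _ _).symm ≪≫
    asIso (Z.map₂ (⟨CausalDiamond.sweep_inclusion hD⟩ :
      D.fromLeft (hD D'.left_mem) ≫ D'.pastBoundary ≫ D.toRight (hD D'.right_mem) ⟶
        D.pastBoundary))

/-- Extend an endomorphism by whiskering on both sides, then conjugate with `inclusionIso`. -/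
def inclusionHom : End (Z.map D'.pastBoundary) →* End (Z.map D.pastBoundary) :=
  (inclusionIso Z hD).conj.toMonoidHom.comp
    (((Bicategory.precomp _ (Z.map (D.fromLeft (hD D'.left_mem)))).mapEnd _).comp
      ((Bicategory.postcomp _ (Z.map (D.toRight (hD D'.right_mem)))).mapEnd _))

lemma inclusionHom_apply (a : End (Z.map D'.pastBoundary)) :
    inclusionHom Z hD a = (inclusionIso Z hD).inv ≫
      (Z.map (D.fromLeft (hD D'.left_mem)) ◁ (show Z.map D'.pastBoundary ⟶ _ from a) ▷
        Z.map (D.toRight (hD D'.right_mem))) ≫ (inclusionIso Z hD).hom := rfl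

/-- The assignment `O ↦ End (Z (past boundary of O))`. -/
def netOf [T2Space X] : PreNet.{u, w₁} M univ where
  obj O := End (Z.map O.diamond.pastBoundary)
  map h := inclusionHom Z (CausalSubset.closedRegion_mono h)

end NetOfFunctor

end LorentzSurface

end

/-! The inclusion map of two nested diamonds is pinned down by an intertwining relation: `b` is the
image of `a` exactly when `a`, extended along the lightlike projections `l` and `r`, is conjugate to
`b` under the image of the 2-morphism from the extended path to the past boundary (`Carries`,
`carries_inclusionHom`). Since 2-morphisms of `C` are invertible, such a `b` is unique
(`Intertwines.eq_right`). Since there is at most one 2-morphism between two paths, it never matters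
which composite of diamonds and associators is used (`Intertwines.congr`). The axioms thus reduce to
finding 2-morphisms between suitable paths.

Geometry: in the null coordinates of one diamond, every path needed is a chain of links, each
running down and then up. Two consecutive links bound a rectangle with the direct link below them
(`sweep_link`), and links do not depend on the coordinates (`link_eq_link`).

Functoriality: for three nested diamonds, projecting in two stages gives paths above the direct
projections. The direct inclusion can therefore be computed on the higher path (`Carries.of_hom`),
where it agrees with the composite (`Carries.trans`).

Locality: of two spacelike separated diamonds one lies to the left of the other
(`rightwards_or_rightwards`), so a single path runs along both past boundaries. On it the two
endomorphisms act on disjoint pieces and commute by the interchange law (`Carries.commute`).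

Injectivity is the assumption on horizontal composition. If 1-morphisms are invertible, whiskering
with them is an equivalence of hom categories, so every inclusion map is bijective. The time-slice
axiom then only asks that the cover be nonempty, which holds because a causal subset contains an
inextendible causal curve, and so a Cauchy surface has a point. -/

/-! ### Horizontal extension of 2-morphisms between images of a pseudofunctor -/

namespace CategoryTheory.Pseudofunctor

open _root_.CategoryTheory.Bicategory

universe w₂ v₂ u₂

variable {B : Type u₂} [Bicategory.{w₂, v₂} B] {C : Type u₁} [Bicategory.{w₁, v₁} C]
  (Z : Pseudofunctor B C)

/-- Extend a 2-morphism between images of 1-morphisms to the left by the image of `l`. -/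
def extendLeft {x y z : B} (l : x ⟶ y) {f g : y ⟶ z} (η : Z.map f ⟶ Z.map g) :
    Z.map (l ≫ f) ⟶ Z.map (l ≫ g) :=
  (Z.mapComp l f).hom ≫ (Z.map l ◁ η) ≫ (Z.mapComp l g).inv

/-- Extend a 2-morphism between images of 1-morphisms to the right by the image of `r`. -/
def extendRight {x y z : B} {f g : x ⟶ y} (η : Z.map f ⟶ Z.map g) (r : y ⟶ z) :
    Z.map (f ≫ r) ⟶ Z.map (g ≫ r) :=
  (Z.mapComp f r).hom ≫ (η ▷ Z.map r) ≫ (Z.mapComp g r).inv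

lemma extendLeft_comp {x y z : B} (l : x ⟶ y) {f g h : y ⟶ z} (η : Z.map f ⟶ Z.map g)
    (θ : Z.map g ⟶ Z.map h) :
    Z.extendLeft l (η ≫ θ) = Z.extendLeft l η ≫ Z.extendLeft l θ := by
  simp [extendLeft]

lemma extendRight_comp {x y z : B} {f g h : x ⟶ y} (η : Z.map f ⟶ Z.map g)
    (θ : Z.map g ⟶ Z.map h) (r : y ⟶ z) :
    Z.extendRight (η ≫ θ) r = Z.extendRight η r ≫ Z.extendRight θ r := by
  simp [extendRight]

lemma extendLeft_map₂ {x y z : B} (l : x ⟶ y) {f g : y ⟶ z} (s : f ⟶ g) :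
    Z.extendLeft l (Z.map₂ s) = Z.map₂ (l ◁ s) := by
  simp [extendLeft]

lemma extendRight_map₂ {x y z : B} {f g : x ⟶ y} (s : f ⟶ g) (r : y ⟶ z) :
    Z.extendRight (Z.map₂ s) r = Z.map₂ (s ▷ r) := by
  simp [extendRight]

/-- This is the interchange law: `s` and `η` act on different factors of the composite. It allows
the extending path to be deformed. -/
lemma extendLeft_naturality {x y z : B} {l l' : x ⟶ y} (s : l ⟶ l') {f g : y ⟶ z}
    (η : Z.map f ⟶ Z.map g) :
    Z.map₂ (s ▷ f) ≫ Z.extendLeft l' η = Z.extendLeft l η ≫ Z.map₂ (s ▷ g) := by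
  simp [extendLeft, whisker_exchange_assoc]

lemma extendRight_naturality {x y z : B} {f g : x ⟶ y} (η : Z.map f ⟶ Z.map g) {r r' : y ⟶ z}
    (s : r ⟶ r') :
    Z.map₂ (f ◁ s) ≫ Z.extendRight η r' = Z.extendRight η r ≫ Z.map₂ (g ◁ s) := by
  simp [extendRight, whisker_exchange_assoc]

/-- Extending in two stages and at once live on differently bracketed paths, so they can only be
compared through the image of the associator. The compatibility of `mapComp` with associators gives
the identity; the next two lemmas are the analogues on the right and in the middle. -/
lemma extendLeft_extendLeft {w x y z : B} (l : w ⟶ x) (l' : x ⟶ y) {f g : y ⟶ z}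
    (η : Z.map f ⟶ Z.map g) :
    Z.map₂ (α_ l l' f).hom ≫ Z.extendLeft l (Z.extendLeft l' η) =
      Z.extendLeft (l ≫ l') η ≫ Z.map₂ (α_ l l' g).hom := by
  simp [extendLeft, whisker_exchange_assoc]

lemma extendRight_extendRight {w x y z : B} {f g : w ⟶ x} (η : Z.map f ⟶ Z.map g) (r : x ⟶ y)
    (r' : y ⟶ z) :
    Z.map₂ (α_ f r r').hom ≫ Z.extendRight η (r ≫ r') =
      Z.extendRight (Z.extendRight η r) r' ≫ Z.map₂ (α_ g r r').hom := by
  simp [extendRight, whisker_exchange_assoc]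

lemma extendLeft_extendRight {w x y z : B} (l : w ⟶ x) {f g : x ⟶ y} (η : Z.map f ⟶ Z.map g)
    (r : y ⟶ z) :
    Z.map₂ (α_ l f r).hom ≫ Z.extendLeft l (Z.extendRight η r) =
      Z.extendRight (Z.extendLeft l η) r ≫ Z.map₂ (α_ l g r).hom := by
  simp [extendLeft, extendRight]

lemma extendLeft_id {x y : B} {f g : x ⟶ y} (η : Z.map f ⟶ Z.map g) :
    Z.extendLeft (𝟙 x) η ≫ Z.map₂ (λ_ g).hom = Z.map₂ (λ_ f).hom ≫ η := by
  simp [extendLeft, whisker_exchange_assoc]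

lemma extendRight_id {x y : B} {f g : x ⟶ y} (η : Z.map f ⟶ Z.map g) :
    Z.extendRight η (𝟙 y) ≫ Z.map₂ (ρ_ g).hom = Z.map₂ (ρ_ f).hom ≫ η := by
  simp [extendRight, ← whisker_exchange_assoc]

/-- Extensions of 2-morphisms on consecutive 1-morphisms commute. -/
lemma extendRight_comp_extendLeft {x y z : B} {f f' : x ⟶ y} {g g' : y ⟶ z}
    (η : Z.map f ⟶ Z.map f') (θ : Z.map g ⟶ Z.map g') :
    Z.extendRight η g ≫ Z.extendLeft f' θ = Z.extendLeft f θ ≫ Z.extendRight η g' := by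
  simp [extendLeft, extendRight, whisker_exchange_assoc]

/-- The 2-morphisms `p` and `q` are intertwined by the image of `s`. -/
def Intertwines {x y : B} {f g : x ⟶ y} (s : f ⟶ g) (p : Z.map f ⟶ Z.map f)
    (q : Z.map g ⟶ Z.map g) : Prop :=
  p ≫ Z.map₂ s = Z.map₂ s ≫ q

/-- The extension of `a` along `l` and `r` is carried to `b` by the image of `s`. -/
def Carries {x x' y' y : B} {l : x ⟶ x'} {f : x' ⟶ y'} {r : y' ⟶ y} {g : x ⟶ y}
    (s : l ≫ f ≫ r ⟶ g) (a : Z.map f ⟶ Z.map f) (b : Z.map g ⟶ Z.map g) : Prop :=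
  Z.Intertwines s (Z.extendLeft l (Z.extendRight a r)) b

variable {Z}

/-! ### Calculus of intertwined endomorphisms -/

namespace Intertwines

lemma trans {x y : B} {f g h : x ⟶ y} {s : f ⟶ g} {t : g ⟶ h} {p : Z.map f ⟶ Z.map f}
    {q : Z.map g ⟶ Z.map g} {r : Z.map h ⟶ Z.map h} (h₁ : Z.Intertwines s p q)
    (h₂ : Z.Intertwines t q r) : Z.Intertwines (s ≫ t) p r := by
  unfold Intertwines at *
  rw [Z.map₂_comp, ← Category.assoc, h₁, Category.assoc, h₂, Category.assoc]

lemma whiskerLeft {x y z : B} (l : x ⟶ y) {f g : y ⟶ z} {s : f ⟶ g} {p : Z.map f ⟶ Z.map f}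
    {q : Z.map g ⟶ Z.map g} (h : Z.Intertwines s p q) :
    Z.Intertwines (l ◁ s) (Z.extendLeft l p) (Z.extendLeft l q) := by
  unfold Intertwines at *
  rw [← extendLeft_map₂, ← extendLeft_comp, h, extendLeft_comp]

lemma whiskerRight {x y z : B} {f g : x ⟶ y} {s : f ⟶ g} {p : Z.map f ⟶ Z.map f}
    {q : Z.map g ⟶ Z.map g} (h : Z.Intertwines s p q) (r : y ⟶ z) :
    Z.Intertwines (s ▷ r) (Z.extendRight p r) (Z.extendRight q r) := by
  unfold Intertwines at *
  rw [← extendRight_map₂, ← extendRight_comp, h, extendRight_comp]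

lemma associator_left {w x y z : B} (l : w ⟶ x) (l' : x ⟶ y) {f : y ⟶ z}
    (p : Z.map f ⟶ Z.map f) :
    Z.Intertwines (α_ l l' f).hom (Z.extendLeft (l ≫ l') p)
      (Z.extendLeft l (Z.extendLeft l' p)) :=
  (Z.extendLeft_extendLeft l l' p).symm

lemma associator_right {w x y z : B} {f : w ⟶ x} (p : Z.map f ⟶ Z.map f) (r : x ⟶ y)
    (r' : y ⟶ z) :
    Z.Intertwines (α_ f r r').hom (Z.extendRight (Z.extendRight p r) r')
      (Z.extendRight p (r ≫ r')) :=
  (Z.extendRight_extendRight p r r').symm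

lemma associator_middle {w x y z : B} (l : w ⟶ x) {f : x ⟶ y} (p : Z.map f ⟶ Z.map f)
    (r : y ⟶ z) :
    Z.Intertwines (α_ l f r).hom (Z.extendRight (Z.extendLeft l p) r)
      (Z.extendLeft l (Z.extendRight p r)) :=
  (Z.extendLeft_extendRight l p r).symm

/-- The image of `s` is invertible, hence can be cancelled on the left. This removes a rebracketing
from the front of a known relation. -/
lemma of_comp [IsLocallyGroupoid C] {x y : B} {f g h : x ⟶ y} {s : f ⟶ g} {t : g ⟶ h}
    {p : Z.map f ⟶ Z.map f} {q : Z.map g ⟶ Z.map g} {r : Z.map h ⟶ Z.map h}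
    (h₁ : Z.Intertwines s p q) (h₂ : Z.Intertwines (s ≫ t) p r) : Z.Intertwines t q r := by
  unfold Intertwines at *
  rw [Z.map₂_comp, ← Category.assoc, h₁, Category.assoc, Category.assoc] at h₂
  exact (cancel_epi _).mp h₂

lemma symm {x y : B} {f g : x ⟶ y} {s : f ≅ g} {p : Z.map f ⟶ Z.map f}
    {q : Z.map g ⟶ Z.map g} (h : Z.Intertwines s.hom p q) : Z.Intertwines s.inv q p := by
  unfold Intertwines at *
  rw [← cancel_epi (Z.map₂ s.hom), ← Category.assoc, ← h, Category.assoc, ← Z.map₂_comp,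
    ← Category.assoc, ← Z.map₂_comp]
  simp

/-- Both candidates are the conjugate of `p` by the invertible image of `s`. Equations between
inclusion maps are proved by this uniqueness. -/
lemma eq_right [IsLocallyGroupoid C] {x y : B} {f g : x ⟶ y} {s : f ⟶ g}
    {p : Z.map f ⟶ Z.map f} {q q' : Z.map g ⟶ Z.map g} (h : Z.Intertwines s p q)
    (h' : Z.Intertwines s p q') : q = q' :=
  (cancel_epi (Z.map₂ s)).mp (Eq.trans (Eq.symm h) h')

/-- Parallel 2-morphisms of `B` coincide. This is what dispenses with all coherence bookkeeping for
paths. -/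
lemma congr [∀ x y : B, Quiver.IsThin (x ⟶ y)] {x y : B} {f g : x ⟶ y} {s : f ⟶ g}
    {p : Z.map f ⟶ Z.map f} {q : Z.map g ⟶ Z.map g} (h : Z.Intertwines s p q) (t : f ⟶ g) :
    Z.Intertwines t p q :=
  Subsingleton.elim s t ▸ h

end Intertwines

/-! ### Transport of endomorphisms along extended paths -/

namespace Carries

variable [∀ x y : B, Quiver.IsThin (x ⟶ y)]

/-- The unitors strip off identity extensions. The paths enter through equations because a
projection of a corner onto itself is a constant path, equal to the identity only after passing to
the quotient. -/
lemma refl {x y : B} {l : x ⟶ x} {f : x ⟶ y} {r : y ⟶ y} (hl : l = 𝟙 x) (hr : r = 𝟙 y)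
    (s : l ≫ f ≫ r ⟶ f) (a : Z.map f ⟶ Z.map f) : Z.Carries s a a := by
  subst hl hr
  exact Intertwines.congr (s := (λ_ _).hom ≫ (ρ_ f).hom)
    (Intertwines.trans (Z.extendLeft_id _) (Z.extendRight_id a)) s

/-- Carrying along paths that are above the given ones. -/
lemma of_hom {x x' y' y : B} {l l' : x ⟶ x'} {f : x' ⟶ y'} {r r' : y' ⟶ y} {g : x ⟶ y}
    {s : l ≫ f ≫ r ⟶ g} {a : Z.map f ⟶ Z.map f} {b : Z.map g ⟶ Z.map g} (h : Z.Carries s a b)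
    (σ : l' ⟶ l) (τ : r' ⟶ r) (s' : l' ≫ f ≫ r' ⟶ g) : Z.Carries s' a b := by
  have h₁ : Z.Intertwines (f ◁ τ) (Z.extendRight a r') (Z.extendRight a r) :=
    (Z.extendRight_naturality a τ).symm
  have h₂ : Z.Intertwines (σ ▷ (f ≫ r)) (Z.extendLeft l' (Z.extendRight a r))
      (Z.extendLeft l (Z.extendRight a r)) :=
    (Z.extendLeft_naturality σ _).symm
  exact (((h₁.whiskerLeft l').trans h₂).trans h).congr s'

lemma trans [IsLocallyGroupoid C] {x x' x'' y'' y' y : B} {l : x ⟶ x'} {l' : x' ⟶ x''}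
    {f : x'' ⟶ y''} {r' : y'' ⟶ y'} {r : y' ⟶ y} {g' : x' ⟶ y'} {g : x ⟶ y}
    {s' : l' ≫ f ≫ r' ⟶ g'} {s : l ≫ g' ≫ r ⟶ g} {a : Z.map f ⟶ Z.map f}
    {b : Z.map g' ⟶ Z.map g'} {c : Z.map g ⟶ Z.map g} (h' : Z.Carries s' a b)
    (h : Z.Carries s b c) (s'' : (l ≫ l') ≫ f ≫ r' ≫ r ⟶ g) : Z.Carries s'' a c := by
  -- Two routes leave `l ≫ (l' ≫ f ≫ r') ≫ r`: rebracketing to the source of `s''`, and carrying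
  -- first to `g'` and then to `g`. Thinness identifies the second with the first followed by `s''`.
  have h₁ := ((Intertwines.associator_middle l' (Z.extendRight a r') r).trans
    ((Intertwines.associator_right a r' r).whiskerLeft l')).whiskerLeft l
  have h₂ := h₁.trans (Intertwines.associator_left l l' (Z.extendRight a (r' ≫ r))).symm
  have h₃ := ((Intertwines.whiskerRight h' r).whiskerLeft l).trans h
  exact h₂.of_comp (h₃.congr _)

/-- What is carried from the left and what is carried from the right commutes. -/
lemma commute [IsLocallyGroupoid C] {x x₁ y₁ x₂ y₂ y : B} {l₁ : x ⟶ x₁} {f₁ : x₁ ⟶ y₁}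
    {r₁ : y₁ ⟶ y} {l₂ : x ⟶ x₂} {f₂ : x₂ ⟶ y₂} {r₂ : y₂ ⟶ y} {g : x ⟶ y} (m : y₁ ⟶ x₂)
    (σ : l₁ ≫ f₁ ≫ m ⟶ l₂) (τ : m ≫ f₂ ≫ r₂ ⟶ r₁) {s₁ : l₁ ≫ f₁ ≫ r₁ ⟶ g}
    {s₂ : l₂ ≫ f₂ ≫ r₂ ⟶ g} {a₁ : Z.map f₁ ⟶ Z.map f₁} {a₂ : Z.map f₂ ⟶ Z.map f₂}
    {b₁ b₂ : Z.map g ⟶ Z.map g} (h₁ : Z.Carries s₁ a₁ b₁) (h₂ : Z.Carries s₂ a₂ b₂) :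
    b₁ ≫ b₂ = b₂ ≫ b₁ := by
  -- Both relations are lifted to the common path `l₁, f₁, m, f₂, r₂`: `τ` replaces `r₁` by `m, f₂,
  -- r₂`, and `σ` replaces `l₂` by `l₁, f₁, m`.
  have k₁ : Z.Intertwines _ _ b₁ := h₁.of_hom (𝟙 l₁) τ ((l₁ ◁ f₁ ◁ τ) ≫ s₁)
  have k₂ : Z.Intertwines _ _ b₂ := h₂.of_hom σ (𝟙 r₂) ((σ ▷ (f₂ ≫ r₂)) ≫ s₂)
  have k₃ := Intertwines.associator_left l₁ (f₁ ≫ m) (Z.extendRight a₂ r₂)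
  have k₄ := (Intertwines.associator_left f₁ m (Z.extendRight a₂ r₂)).whiskerLeft l₁
  -- After rebracketing, `b₂` is intertwined along the same 2-morphism as `b₁`, so commutation can
  -- be checked upstairs.
  have k₅ := (k₃.trans k₄).of_comp (k₂.congr (_ ≫ (l₁ ◁ f₁ ◁ τ) ≫ s₁))
  -- Upstairs, `a₁` acts on `f₁` and `a₂` on the remainder `m, f₂, r₂`; these commute by
  -- interchange.
  have k₆ := congrArg (Z.extendLeft l₁)
    (Z.extendRight_comp_extendLeft a₁ (Z.extendLeft m (Z.extendRight a₂ r₂)))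
  rw [extendLeft_comp, extendLeft_comp] at k₆
  unfold Intertwines at k₁ k₅
  rw [← cancel_epi (Z.map₂ ((l₁ ◁ f₁ ◁ τ) ≫ s₁)), ← Category.assoc, ← k₁, Category.assoc, ← k₅,
    ← Category.assoc, k₆, Category.assoc, k₁, ← Category.assoc, k₅, Category.assoc]

end Carries

end CategoryTheory.Pseudofunctor

namespace LorentzSurface

/-! ### Composition with invertible 1-morphisms -/

section OneMorphisms

variable {C : Type u₁} [Bicategory.{w₁, v₁} C]

/-- Precomposition with a weak inverse `g` of `f` is a quasi-inverse. Precomposition reverses order,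
so the unit comes from `g ≫ f ≅ 𝟙 b` and the counit from `f ≫ g ≅ 𝟙 a`; for postcomposition the
roles are exchanged. -/
lemma OneMorphismsInvertible.isEquivalence_precomp (hC : OneMorphismsInvertible C) {a b : C}
    (f : a ⟶ b) (c : C) : (Bicategory.precomp c f).IsEquivalence := by
  obtain ⟨g, ⟨i⟩, ⟨j⟩⟩ := hC f
  exact .mk' (Bicategory.precomp c g)
    ((Bicategory.leftUnitorNatIso b c).symm ≪≫ (Bicategory.precomposing b b c).mapIso j.symm ≪≫
      Bicategory.associatorNatIsoRight g f c)
    ((Bicategory.associatorNatIsoRight f g c).symm ≪≫ (Bicategory.precomposing a a c).mapIso i ≪≫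
      Bicategory.leftUnitorNatIso a c)

lemma OneMorphismsInvertible.isEquivalence_postcomp (hC : OneMorphismsInvertible C) {a b : C}
    (f : a ⟶ b) (c : C) : (Bicategory.postcomp c f).IsEquivalence := by
  obtain ⟨g, ⟨i⟩, ⟨j⟩⟩ := hC f
  exact .mk' (Bicategory.postcomp c g)
    ((Bicategory.rightUnitorNatIso c a).symm ≪≫ (Bicategory.postcomposing c a a).mapIso i.symm ≪≫
      (Bicategory.associatorNatIsoLeft c f g).symm)
    (Bicategory.associatorNatIsoLeft c g f ≪≫ (Bicategory.postcomposing c b b).mapIso j ≪≫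
      Bicategory.rightUnitorNatIso c b)

variable {X : Type u} [TopologicalSpace X]
  [ChartedSpace (EuclideanSpace ℝ (Fin 2)) X] [IsManifold (𝓡 2) ∞ X] {M : LorentzSurface X}

/-- Equivalences of hom categories are faithful. -/
lemma OneMorphismsInvertible.horizontallyInjective (hC : OneMorphismsInvertible C)
    (Z : Pseudofunctor (PathTwoCat M) C) : HorizontallyInjective Z := by
  intro x y f c
  have := hC.isEquivalence_precomp (Z.map f) c
  have := hC.isEquivalence_postcomp (Z.map f) c
  exact ⟨fun g h ↦ (Bicategory.precomp c (Z.map f)).map_injective,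
    fun g h ↦ (Bicategory.postcomp c (Z.map f)).map_injective⟩

end OneMorphisms

namespace CausalDiamond

variable {X : Type u} [TopologicalSpace X]
  [ChartedSpace (EuclideanSpace ℝ (Fin 2)) X] [IsManifold (𝓡 2) ∞ X] {M : LorentzSurface X}
  (D : CausalDiamond M)

/-! ### Links between points of a closed diamond -/

/-- The point with coordinates `w` is to the right of (and spacelike or lightlike to) the point with
coordinates `z`, both in the closed diamond. -/
structure Rightwards (z w : ℝ × ℝ) : Prop where
  fst_mem : D.u₀ ≤ z.1
  fst_le : z.1 ≤ w.1
  fst_mem' : w.1 ≤ D.u₁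
  snd_mem : z.2 ≤ D.v₁
  snd_le : w.2 ≤ z.2
  snd_mem' : D.v₀ ≤ w.2

variable {D}

lemma Rightwards.trans {z w w' : ℝ × ℝ} (h : D.Rightwards z w) (h' : D.Rightwards w w') :
    D.Rightwards z w' :=
  ⟨h.fst_mem, h.fst_le.trans h'.fst_le, h'.fst_mem', h.snd_mem, h'.snd_le.trans h.snd_le,
    h'.snd_mem'⟩

lemma Rightwards.refl {z : ℝ × ℝ} (hz : z ∈ Icc D.u₀ D.u₁ ×ˢ Icc D.v₀ D.v₁) : D.Rightwards z z :=
  ⟨hz.1.1, le_rfl, hz.1.2, hz.2.2, le_rfl, hz.2.1⟩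

lemma Rightwards.left {z : ℝ × ℝ} (hz : z ∈ Icc D.u₀ D.u₁ ×ˢ Icc D.v₀ D.v₁) :
    D.Rightwards (D.u₀, D.v₁) z :=
  ⟨le_rfl, hz.1.1, hz.1.2, le_rfl, hz.2.2, hz.2.1⟩

lemma Rightwards.right {z : ℝ × ℝ} (hz : z ∈ Icc D.u₀ D.u₁ ×ˢ Icc D.v₀ D.v₁) :
    D.Rightwards z (D.u₁, D.v₀) :=
  ⟨hz.1.1, hz.1.2, le_rfl, hz.2.2, hz.2.1, le_rfl⟩

variable (D) in
/-- The path that runs down and then up, from the point with coordinates `z` to the point with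
coordinates `w`. -/
def link {z w : ℝ × ℝ} (h : D.Rightwards z w) {x y : X} (hx : D.chart.toChart.symm z = x)
    (hy : D.chart.toChart.symm w = y) : (⟨x⟩ : PathTwoCat M) ⟶ ⟨y⟩ :=
  D.down (u := z.1) h.snd_mem h.snd_le h.snd_mem' h.fst_mem (h.fst_le.trans h.fst_mem') hx rfl ≫
    D.up (v := w.2) h.fst_mem h.fst_le h.fst_mem' h.snd_mem' (h.snd_le.trans h.snd_mem) rfl hy

/-- The definition of `link` fixes the expression for its lowest point. Here that point may carry
any name `p`, as needed for past boundaries and for paths coming from another chart. -/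
lemma down_comp_up_eq_link {u u' v v' : ℝ} (h : D.Rightwards (u, v) (u', v')) {x y p : X}
    (hx : D.chart.toChart.symm (u, v) = x) (hy : D.chart.toChart.symm (u', v') = y)
    (hp : D.chart.toChart.symm (u, v') = p) :
    D.down h.snd_mem h.snd_le h.snd_mem' h.fst_mem (h.fst_le.trans h.fst_mem') hx hp ≫
      D.up h.fst_mem h.fst_le h.fst_mem' h.snd_mem' (h.snd_le.trans h.snd_mem) hp hy =
    D.link h hx hy := by
  subst hp
  rfl

lemma link_self {z : ℝ × ℝ} (h : D.Rightwards z z) {x : X} (hx hy : D.chart.toChart.symm z = x) :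
    D.link h hx hy = 𝟙 _ := by
  subst hx
  unfold link
  rw [down_self, up_self, Category.comp_id]

/-- A chain of two links lies above the direct link. -/
lemma sweep_link {z w w' : ℝ × ℝ} (h : D.Rightwards z w) (h' : D.Rightwards w w') {x y y' : X}
    (hx : D.chart.toChart.symm z = x) (hy : D.chart.toChart.symm w = y)
    (hy' : D.chart.toChart.symm w' = y') :
    Sweep (D.link h hx hy ≫ D.link h' hy hy') (D.link (h.trans h') hx hy') := by
  -- The upward half of the first link and the downward half of the second are the future boundary
  -- of the rectangle `[z.1, w.1] × [w'.2, w.2]`. Sweeping it leaves two downward and two upward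
  -- pieces, which merge.
  have s := D.sweep_rect h.fst_mem h.fst_le h.fst_mem' h'.snd_mem' h'.snd_le
    (h.snd_le.trans h.snd_mem) rfl hy rfl rfl
  have t := Sweep.whiskerLeft
    (D.down (u := z.1) h.snd_mem h.snd_le h.snd_mem' h.fst_mem (h.fst_le.trans h.fst_mem') hx rfl)
    (s.whiskerRight (D.up (v := w'.2) h'.fst_mem h'.fst_le h'.fst_mem' h'.snd_mem'
      (h'.snd_le.trans h'.snd_mem) rfl hy'))
  unfold link
  simp only [Category.assoc] at t ⊢
  refine t.trans ?_
  rw [up_comp_up, ← Category.assoc, down_comp_down]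
  exact .refl _

lemma fromLeft_eq_link {x : X} (hx : x ∈ D.closedRegion) :
    D.fromLeft hx = D.link (.left (D.coord_mem hx)) D.left_eq (D.symm_coord hx) := rfl

lemma toRight_eq_link {x : X} (hx : x ∈ D.closedRegion) :
    D.toRight hx = D.link (.right (D.coord_mem hx)) (D.symm_coord hx) D.right_eq := rfl

variable (D) in
lemma left_rightwards_right : D.Rightwards (D.u₀, D.v₁) (D.u₁, D.v₀) :=
  ⟨le_rfl, D.u_lt.le, le_rfl, le_rfl, D.v_lt.le, le_rfl⟩

variable (D) in
lemma pastBoundary_eq_link :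
    D.pastBoundary = D.link D.left_rightwards_right D.left_eq D.right_eq :=
  down_comp_up_eq_link _ _ _ _

/-! ### Links under change of null coordinates -/

variable {D' : CausalDiamond M}

lemma coord_fst_eq (hD : D'.closedRegion ⊆ D.closedRegion) {u v v' : ℝ}
    (hu : u ∈ Icc D'.u₀ D'.u₁) (hv : v ∈ Icc D'.v₀ D'.v₁) (hv' : v' ∈ Icc D'.v₀ D'.v₁) :
    (D.chart.toChart (D'.chart.toChart.symm (u, v))).1 =
      (D.chart.toChart (D'.chart.toChart.symm (u, v'))).1 :=
  ((coord_down hD hu).2.2 v hv).trans ((coord_down hD hu).2.2 v' hv').symm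

lemma coord_snd_eq (hD : D'.closedRegion ⊆ D.closedRegion) {u u' v : ℝ}
    (hu : u ∈ Icc D'.u₀ D'.u₁) (hu' : u' ∈ Icc D'.u₀ D'.u₁) (hv : v ∈ Icc D'.v₀ D'.v₁) :
    (D.chart.toChart (D'.chart.toChart.symm (u, v))).2 =
      (D.chart.toChart (D'.chart.toChart.symm (u', v))).2 :=
  ((coord_up hD hv).2.2 u hu).trans ((coord_up hD hv).2.2 u' hu').symm

lemma Rightwards.mem_left {z w : ℝ × ℝ} (h : D.Rightwards z w) :
    z ∈ Icc D.u₀ D.u₁ ×ˢ Icc D.v₀ D.v₁ :=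
  ⟨⟨h.fst_mem, h.fst_le.trans h.fst_mem'⟩, ⟨h.snd_mem'.trans h.snd_le, h.snd_mem⟩⟩

lemma Rightwards.mem_right {z w : ℝ × ℝ} (h : D.Rightwards z w) :
    w ∈ Icc D.u₀ D.u₁ ×ˢ Icc D.v₀ D.v₁ :=
  ⟨⟨h.fst_mem.trans h.fst_le, h.fst_mem'⟩, ⟨h.snd_mem', h.snd_le.trans h.snd_mem⟩⟩

/-- Changes of null coordinates preserve the relation of being to the right. -/
lemma Rightwards.coord (hD : D'.closedRegion ⊆ D.closedRegion) {z w : ℝ × ℝ}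
    (h : D'.Rightwards z w) :
    D.Rightwards (D.chart.toChart (D'.chart.toChart.symm z))
      (D.chart.toChart (D'.chart.toChart.symm w)) := by
  obtain ⟨u, v⟩ := z
  obtain ⟨u', v'⟩ := w
  have hz := h.mem_left
  have hw := h.mem_right
  have cz := D.coord_mem (hD (D'.symm_mem hz))
  have cw := D.coord_mem (hD (D'.symm_mem hw))
  refine ⟨cz.1.1, ?_, cw.1.2, cz.2.2, ?_, cw.2.1⟩
  -- The new first coordinate does not depend on `v`, so `z` may be moved to the `u`-line of `w`,
  -- along which that coordinate is monotone.
  · rw [coord_fst_eq hD hz.1 hz.2 hw.2]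
    exact (coord_up hD hw.2).2.1.monotoneOn hz.1 hw.1 h.fst_le
  · rw [coord_snd_eq hD hw.1 hz.1 hw.2]
    exact (coord_down hD hz.1).2.1.monotoneOn hw.2 hz.2 h.snd_le

/-- Links do not depend on the null coordinates. -/
lemma link_eq_link (hD : D'.closedRegion ⊆ D.closedRegion) {z w z' w' : ℝ × ℝ}
    (h : D'.Rightwards z w) {x y : X} (hx : D'.chart.toChart.symm z = x)
    (hy : D'.chart.toChart.symm w = y) (h' : D.Rightwards z' w')
    (hx' : D.chart.toChart.symm z' = x) (hy' : D.chart.toChart.symm w' = y) :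
    D'.link h hx hy = D.link h' hx' hy' := by
  have hz : D.chart.toChart (D'.chart.toChart.symm z) = z' := by
    rw [hx, ← hx', D.chart.toChart.right_inv (D.rect_subset h'.mem_left)]
  have hw : D.chart.toChart (D'.chart.toChart.symm w) = w' := by
    rw [hy, ← hy', D.chart.toChart.right_inv (D.rect_subset h'.mem_right)]
  obtain ⟨u, v⟩ := z
  obtain ⟨u', v'⟩ := w
  have hm := D'.symm_mem (z := (u, v')) ⟨h.mem_left.1, h.mem_right.2⟩
  -- The lowest points of the two links agree, since lightlike lines of either kind are preserved by
  -- the coordinate change. The halves can then be compared separately.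
  have hp : D.chart.toChart.symm (z'.1, w'.2) = D'.chart.toChart.symm (u, v') := by
    rw [← hz, ← hw, coord_fst_eq hD h.mem_left.1 h.mem_left.2 h.mem_right.2,
      coord_snd_eq hD h.mem_right.1 h.mem_left.1 h.mem_right.2]
    exact D.symm_coord (hD hm)
  obtain ⟨a, b⟩ := z'
  obtain ⟨a', b'⟩ := w'
  rw [← down_comp_up_eq_link h' hx' hy' hp, ← down_comp_up_eq_link h hx hy rfl]
  congr 1
  · exact down_eq_down hD _ _ _ _ _ _ _ _ _ _ _ _ _ _
  · exact up_eq_up hD _ _ _ _ _ _ _ _ _ _ _ _ _ _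

end CausalDiamond
end LorentzSurface

namespace LorentzSurface

variable {X : Type u} [TopologicalSpace X]
  [ChartedSpace (EuclideanSpace ℝ (Fin 2)) X] [IsManifold (𝓡 2) ∞ X] {M : LorentzSurface X}

/-! ### Causal relations in larger ambient sets -/

lemma CausalLE.mono {Y Y' : Set X} (hY : Y ⊆ Y') {p q : X} (h : M.CausalLE Y p q) :
    M.CausalLE Y' p q :=
  Relation.ReflTransGen.mono (r := M.CausalStep Y) (p := M.CausalStep Y')
    (fun _ _ ⟨γ, a, b, hab, ha, hb, hc, hγ⟩ ↦
      ⟨γ, a, b, hab, ha, hb, hc, fun t ht ↦ ⟨hY (hγ t ht).1, (hγ t ht).2⟩⟩) _ _ h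

lemma SpacelikeSeparated.mono {Y Y' O₁ O₂ : Set X} (hY : Y ⊆ Y')
    (h : M.SpacelikeSeparated Y' O₁ O₂) : M.SpacelikeSeparated Y O₁ O₂ :=
  fun x₁ h₁ x₂ h₂ ↦ ⟨fun hc ↦ (h x₁ h₁ x₂ h₂).1 (hc.mono hY),
    fun hc ↦ (h x₁ h₁ x₂ h₂).2 (hc.mono hY)⟩

namespace CausalDiamond

variable {D D' D'' : CausalDiamond M}

/-! ### 2-morphisms between paths through nested diamonds -/

lemma pastBoundary_eq_link_of_subset (hD : D'.closedRegion ⊆ D.closedRegion) :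
    D'.pastBoundary = D.link (D'.left_rightwards_right.coord hD) (D.symm_coord (hD D'.left_mem))
      (D.symm_coord (hD D'.right_mem)) := by
  rw [pastBoundary_eq_link]
  exact link_eq_link hD _ _ _ _ _ _

/-- The endpoint of `fromLeft` is read off from the chart and is not syntactically `(u₀, v₁)`.
Taking both diamonds equal in `link_eq_link` makes the replacement. -/
lemma fromLeft_left : D.fromLeft D.left_mem = 𝟙 _ := by
  rw [fromLeft_eq_link, ← D.link_self (.refl ⟨⟨le_rfl, D.u_lt.le⟩, ⟨D.v_lt.le, le_rfl⟩⟩) D.left_eq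
    D.left_eq]
  exact link_eq_link subset_rfl _ _ _ _ _ _

lemma toRight_right : D.toRight D.right_mem = 𝟙 _ := by
  rw [toRight_eq_link, ← D.link_self (.refl ⟨⟨D.u_lt.le, le_rfl⟩, ⟨le_rfl, D.v_lt.le⟩⟩) D.right_eq
    D.right_eq]
  exact link_eq_link subset_rfl _ _ _ _ _ _

/-- Rewritten in the coordinates of `D`, the second path is a link, so `sweep_link` applies. In
general the two-stage projection only lies above the direct one; with `sweep_toRight` this provides
the 2-morphisms for functoriality. -/
lemma sweep_fromLeft (hD : D'.closedRegion ⊆ D.closedRegion) {x : X} (hx : x ∈ D'.closedRegion) :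
    Sweep (D.fromLeft (hD D'.left_mem) ≫ D'.fromLeft hx) (D.fromLeft (hD hx)) := by
  have h := Rightwards.coord hD (.left (D'.coord_mem hx))
  rw [D'.symm_coord hx] at h
  have e : D'.fromLeft hx = D.link h (D.symm_coord (hD D'.left_mem)) (D.symm_coord (hD hx)) :=
    link_eq_link hD (.left (D'.coord_mem hx)) _ _ _ _ _
  rw [e]
  exact sweep_link (.left (D.coord_mem (hD D'.left_mem))) h _ _ _

lemma sweep_toRight (hD : D'.closedRegion ⊆ D.closedRegion) {x : X} (hx : x ∈ D'.closedRegion) :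
    Sweep (D'.toRight hx ≫ D.toRight (hD D'.right_mem)) (D.toRight (hD hx)) := by
  have h := Rightwards.coord hD (.right (D'.coord_mem hx))
  rw [D'.symm_coord hx] at h
  have e : D'.toRight hx = D.link h (D.symm_coord (hD hx)) (D.symm_coord (hD D'.right_mem)) :=
    link_eq_link hD (.right (D'.coord_mem hx)) _ _ _ _ _
  rw [e]
  exact sweep_link h (.right (D.coord_mem (hD D'.right_mem))) _ _ _

variable {D₁ D₂ : CausalDiamond M}

/-- The path in `D` from the right corner of `D₁` to the left corner of `D₂`. -/
def bridge (h₁ : D₁.closedRegion ⊆ D.closedRegion) (h₂ : D₂.closedRegion ⊆ D.closedRegion)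
    (h : D.Rightwards (D.chart.toChart D₁.right) (D.chart.toChart D₂.left)) :
    (⟨D₁.right⟩ : PathTwoCat M) ⟶ ⟨D₂.left⟩ :=
  D.link h (D.symm_coord (h₁ D₁.right_mem)) (D.symm_coord (h₂ D₂.left_mem))

lemma sweep_bridge_left (h₁ : D₁.closedRegion ⊆ D.closedRegion)
    (h₂ : D₂.closedRegion ⊆ D.closedRegion)
    (h : D.Rightwards (D.chart.toChart D₁.right) (D.chart.toChart D₂.left)) :
    Sweep (D.fromLeft (h₁ D₁.left_mem) ≫ D₁.pastBoundary ≫ bridge h₁ h₂ h)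
      (D.fromLeft (h₂ D₂.left_mem)) := by
  rw [pastBoundary_eq_link_of_subset h₁]
  have h' := D₁.left_rightwards_right.coord h₁
  exact ((sweep_link h' h _ _ _).whiskerLeft _).trans
    (sweep_link (.left (D.coord_mem (h₁ D₁.left_mem))) (h'.trans h) _ _ _)

lemma sweep_bridge_right (h₁ : D₁.closedRegion ⊆ D.closedRegion)
    (h₂ : D₂.closedRegion ⊆ D.closedRegion)
    (h : D.Rightwards (D.chart.toChart D₁.right) (D.chart.toChart D₂.left)) :
    Sweep (bridge h₁ h₂ h ≫ D₂.pastBoundary ≫ D.toRight (h₂ D₂.right_mem))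
      (D.toRight (h₁ D₁.right_mem)) := by
  rw [pastBoundary_eq_link_of_subset h₂]
  have h' := D₂.left_rightwards_right.coord h₂
  have h'' : D.Rightwards (D.chart.toChart D₂.right) (D.u₁, D.v₀) :=
    .right (D.coord_mem (h₂ D₂.right_mem))
  exact ((sweep_link h' h'' _ _ _).whiskerLeft _).trans (sweep_link h (h'.trans h'') _ _ _)

/-! ### Spacelike separated diamonds -/

lemma region_subset_closedRegion : D.region ⊆ D.closedRegion := interior_subset

lemma isOpen_image_symm_Ioo :
    IsOpen (D.chart.toChart.symm '' (Ioo D.u₀ D.u₁ ×ˢ Ioo D.v₀ D.v₁)) :=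
  D.chart.toChart.isOpen_image_symm_of_subset_target (isOpen_Ioo.prod isOpen_Ioo)
    ((Set.prod_mono Ioo_subset_Icc_self Ioo_subset_Icc_self).trans D.rect_subset)

variable (D) in
/-- A causal subset is an open rectangle in null coordinates. -/
lemma region_eq : D.region = D.chart.toChart.symm '' (Ioo D.u₀ D.u₁ ×ˢ Ioo D.v₀ D.v₁) := by
  apply Subset.antisymm
  · intro x hx
    have hxc := D.region_subset_closedRegion hx
    -- The chart image of the region is open and contained in the closed rectangle, hence in its
    -- interior.
    refine ⟨_, ?_, D.symm_coord hxc⟩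
    have ho : IsOpen (D.chart.toChart '' D.region) :=
      D.chart.toChart.isOpen_image_of_subset_source isOpen_interior
        (D.region_subset_closedRegion.trans D.closedRegion_subset_source)
    have hs : D.chart.toChart '' D.region ⊆ Icc D.u₀ D.u₁ ×ˢ Icc D.v₀ D.v₁ := by
      rintro _ ⟨y, hy, rfl⟩
      exact D.coord_mem (D.region_subset_closedRegion hy)
    have := interior_maximal hs ho (mem_image_of_mem _ hx)
    rwa [interior_prod_eq, interior_Icc, interior_Icc] at this
  · refine interior_maximal ?_ D.isOpen_image_symm_Ioo
    rw [D.inter_eq]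
    exact image_mono (Set.prod_mono Ioo_subset_Icc_self Ioo_subset_Icc_self)

variable (D) in
lemma closedRegion_subset_closure : D.closedRegion ⊆ closure D.region := by
  have h : closure (Ioo D.u₀ D.u₁ ×ˢ Ioo D.v₀ D.v₁) = Icc D.u₀ D.u₁ ×ˢ Icc D.v₀ D.v₁ := by
    rw [closure_prod_eq, closure_Ioo D.u_lt.ne, closure_Ioo D.v_lt.ne]
  rw [region_eq, closedRegion_eq, ← h]
  refine ContinuousOn.image_closure ?_
  rw [h]
  exact D.chart.toChart.continuousOn_symm.mono D.rect_subset

variable (D) in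
lemma q_mem_closedRegion : D.q ∈ D.closedRegion := by
  rw [← D.q_eq]
  exact D.symm_mem ⟨⟨D.u_lt.le, le_rfl⟩, ⟨D.v_lt.le, le_rfl⟩⟩

/-- The left corner lies on a `v`-line with `p` and on a `u`-line with `q`. Together with
`coord_right` this expresses the relative position of diamonds through `p` and `q` alone. -/
lemma coord_left (hD : D'.closedRegion ⊆ D.closedRegion) :
    D.chart.toChart D'.left = ((D.chart.toChart D'.p).1, (D.chart.toChart D'.q).2) := by
  rw [← D'.p_eq, ← D'.q_eq]
  have hu := D'.u_lt.le
  have hv := D'.v_lt.le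
  exact Prod.ext (coord_fst_eq hD ⟨le_rfl, hu⟩ ⟨hv, le_rfl⟩ ⟨le_rfl, hv⟩)
    (coord_snd_eq hD ⟨le_rfl, hu⟩ ⟨hu, le_rfl⟩ ⟨hv, le_rfl⟩)

lemma coord_right (hD : D'.closedRegion ⊆ D.closedRegion) :
    D.chart.toChart D'.right = ((D.chart.toChart D'.q).1, (D.chart.toChart D'.p).2) := by
  rw [← D'.p_eq, ← D'.q_eq]
  have hu := D'.u_lt.le
  have hv := D'.v_lt.le
  exact Prod.ext (coord_fst_eq hD ⟨hu, le_rfl⟩ ⟨le_rfl, hv⟩ ⟨hv, le_rfl⟩)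
    (coord_snd_eq hD ⟨hu, le_rfl⟩ ⟨le_rfl, hu⟩ ⟨le_rfl, hv⟩)

lemma coord_p_fst_lt (hD : D'.closedRegion ⊆ D.closedRegion) :
    (D.chart.toChart D'.p).1 < (D.chart.toChart D'.q).1 := by
  have h := congrArg Prod.fst (coord_right hD)
  dsimp only at h
  rw [← h, ← D'.p_eq]
  exact (coord_up hD ⟨le_rfl, D'.v_lt.le⟩).2.1 ⟨le_rfl, D'.u_lt.le⟩ ⟨D'.u_lt.le, le_rfl⟩ D'.u_lt

lemma coord_p_snd_lt (hD : D'.closedRegion ⊆ D.closedRegion) :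
    (D.chart.toChart D'.p).2 < (D.chart.toChart D'.q).2 := by
  have h := congrArg Prod.snd (coord_left hD)
  dsimp only at h
  rw [← h, ← D'.p_eq]
  exact (coord_down hD ⟨le_rfl, D'.u_lt.le⟩).2.1 ⟨le_rfl, D'.v_lt.le⟩ ⟨D'.v_lt.le, le_rfl⟩ D'.v_lt

/-- The open diamond is dense in the closed one and the chart is continuous. Corners can thus be
approximated by interior points, the only points that spacelike separation speaks of. -/
lemma exists_mem_region (hD : D'.closedRegion ⊆ D.closedRegion) {x : X} (hx : x ∈ D'.closedRegion)
    {s : Set (ℝ × ℝ)} (hs : IsOpen s) (hxs : D.chart.toChart x ∈ s) :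
    ∃ y ∈ D'.region, D.chart.toChart y ∈ s := by
  have hc := D.chart.toChart.continuousAt (D.closedRegion_subset_source (hD hx))
  obtain ⟨y, hy, hy'⟩ := mem_closure_iff_nhds.mp (D'.closedRegion_subset_closure hx) _
    (hc.preimage_mem_nhds (hs.mem_nhds hxs))
  exact ⟨y, hy', hy⟩

lemma exists_causalLE (h₁ : D₁.closedRegion ⊆ D.closedRegion)
    (h₂ : D₂.closedRegion ⊆ D.closedRegion)
    (hu : (D.chart.toChart D₁.p).1 < (D.chart.toChart D₂.q).1)
    (hv : (D.chart.toChart D₁.p).2 < (D.chart.toChart D₂.q).2) :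
    ∃ x₁ ∈ D₁.region, ∃ x₂ ∈ D₂.region, M.CausalLE D.Y x₁ x₂ := by
  -- The point `(c, d)` separates the two corners: a point of the first region near `p` stays below
  -- it in both coordinates, a point of the second near `q` stays above.
  obtain ⟨c, hc, hc'⟩ := exists_between hu
  obtain ⟨d, hd, hd'⟩ := exists_between hv
  obtain ⟨x₁, hx₁, hx₁'⟩ := exists_mem_region h₁ D₁.p_mem_closedRegion
    (isOpen_Iio.prod isOpen_Iio) (s := Iio c ×ˢ Iio d) ⟨hc, hd⟩
  obtain ⟨x₂, hx₂, hx₂'⟩ := exists_mem_region h₂ D₂.q_mem_closedRegion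
    (isOpen_Ioi.prod isOpen_Ioi) (s := Ioi c ×ˢ Ioi d) ⟨hc', hd'⟩
  have m₁ := h₁ (D₁.region_subset_closedRegion hx₁)
  have m₂ := h₂ (D₂.region_subset_closedRegion hx₂)
  refine ⟨x₁, hx₁, x₂, hx₂, ?_⟩
  rw [← D.symm_coord m₁, ← D.symm_coord m₂]
  exact D.causalLE_of_le (D.coord_mem m₁) (D.coord_mem m₂)
    ⟨(hx₁'.1.trans hx₂'.1).le, (hx₁'.2.trans hx₂'.2).le⟩

/-- Of two spacelike separated diamonds one is to the left of the other. -/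
lemma rightwards_or_rightwards (h₁ : D₁.closedRegion ⊆ D.closedRegion)
    (h₂ : D₂.closedRegion ⊆ D.closedRegion)
    (hs : M.SpacelikeSeparated D.Y D₁.region D₂.region) :
    D.Rightwards (D.chart.toChart D₁.right) (D.chart.toChart D₂.left) ∨
      D.Rightwards (D.chart.toChart D₂.right) (D.chart.toChart D₁.left) := by
  have n₁ : ¬ ((D.chart.toChart D₁.p).1 < (D.chart.toChart D₂.q).1 ∧
      (D.chart.toChart D₁.p).2 < (D.chart.toChart D₂.q).2) := fun ⟨hu, hv⟩ ↦ by
    obtain ⟨x₁, hx₁, x₂, hx₂, h⟩ := exists_causalLE h₁ h₂ hu hv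
    exact (hs x₁ hx₁ x₂ hx₂).1 h
  have n₂ : ¬ ((D.chart.toChart D₂.p).1 < (D.chart.toChart D₁.q).1 ∧
      (D.chart.toChart D₂.p).2 < (D.chart.toChart D₁.q).2) := fun ⟨hu, hv⟩ ↦ by
    obtain ⟨x₂, hx₂, x₁, hx₁, h⟩ := exists_causalLE h₂ h₁ hu hv
    exact (hs x₁ hx₁ x₂ hx₂).2 h
  have u₁ := coord_p_fst_lt h₁
  have v₁ := coord_p_snd_lt h₁
  have u₂ := coord_p_fst_lt h₂
  have v₂ := coord_p_snd_lt h₂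
  have p₁ := D.coord_mem (h₁ D₁.p_mem_closedRegion)
  have q₁ := D.coord_mem (h₁ D₁.q_mem_closedRegion)
  have p₂ := D.coord_mem (h₂ D₂.p_mem_closedRegion)
  have q₂ := D.coord_mem (h₂ D₂.q_mem_closedRegion)
  rw [coord_left h₁, coord_left h₂, coord_right h₁, coord_right h₂]
  rw [not_and_or, not_lt, not_lt] at n₁ n₂
  -- If both separations occurred in the same coordinate, they would contradict that `p` precedes
  -- `q` in each diamond. The mixed cases are the two left-right orders.
  rcases n₁ with n₁ | n₁ <;> rcases n₂ with n₂ | n₂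
  · linarith
  · exact .inr ⟨q₂.1.1, n₁, p₁.1.2, p₂.2.2, n₂, q₁.2.1⟩
  · exact .inl ⟨q₁.1.1, n₂, p₂.1.2, p₁.2.2, n₁, q₂.2.1⟩
  · linarith

/-! ### An inextendible causal curve -/

/-- The diagonal of a causal subset from `p` to `q`. -/
lemma exists_inextendibleCausalCurve [T2Space X] (D : CausalDiamond M) :
    ∃ γ, M.InextendibleCausalCurve D.region γ := by
  have hu := D.u_lt
  have hv := D.v_lt
  -- The diagonal is parametrized by the sigmoid, so that all of `ℝ` runs through its interior and
  -- the limits at `±∞` are the corners `q` and `p`. These lie outside the region, and limits are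
  -- unique in a Hausdorff space.
  set c : ℝ → ℝ × ℝ := fun t ↦
    (D.u₀ + t * (D.u₁ - D.u₀), D.v₀ + t * (D.v₁ - D.v₀)) with hc
  have hcIoo : ∀ t : ℝ, c t.sigmoid ∈ Ioo D.u₀ D.u₁ ×ˢ Ioo D.v₀ D.v₁ := fun t ↦ by
    have h0 := Real.sigmoid_pos t
    have h1 := Real.sigmoid_lt_one t
    refine ⟨⟨?_, ?_⟩, ⟨?_, ?_⟩⟩ <;> simp only [hc] <;> nlinarith
  have htarget : ∀ t : ℝ, c t.sigmoid ∈ D.chart.toChart.target := fun t ↦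
    D.rect_subset (Set.prod_mono Ioo_subset_Icc_self Ioo_subset_Icc_self (hcIoo t))
  have hcont : Continuous c := by fun_prop
  have hp : D.p ∉ D.region := by
    rw [region_eq]
    rintro ⟨z, hz, he⟩
    have := D.chart.toChart.symm.injOn
      (D.rect_subset (Set.prod_mono Ioo_subset_Icc_self Ioo_subset_Icc_self hz))
      (D.mem_target ⟨le_rfl, hu.le⟩ ⟨le_rfl, hv.le⟩) (he.trans D.p_eq.symm)
    rw [this] at hz
    exact lt_irrefl _ hz.1.1
  have hq : D.q ∉ D.region := by
    rw [region_eq]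
    rintro ⟨z, hz, he⟩
    have := D.chart.toChart.symm.injOn
      (D.rect_subset (Set.prod_mono Ioo_subset_Icc_self Ioo_subset_Icc_self hz))
      (D.mem_target ⟨hu.le, le_rfl⟩ ⟨hv.le, le_rfl⟩) (he.trans D.q_eq.symm)
    rw [this] at hz
    exact lt_irrefl _ hz.1.2
  have hlim : ∀ {l : Filter ℝ} {s : ℝ}, Tendsto Real.sigmoid l (𝓝 s) →
      c s ∈ D.chart.toChart.target →
      Tendsto (fun t : ℝ ↦ D.chart.toChart.symm (c t.sigmoid)) l
        (𝓝 (D.chart.toChart.symm (c s))) := fun hl hs ↦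
    (D.chart.toChart.continuousAt_symm hs).tendsto.comp ((hcont.tendsto _).comp hl)
  have hc0 : c 0 = (D.u₀, D.v₀) := by simp [hc]
  have hc1 : c 1 = (D.u₁, D.v₁) := by simp [hc]
  refine ⟨fun t ↦ D.chart.toChart.symm (c t.sigmoid), ?_, ?_, ?_, ?_, ?_⟩
  · rw [← contMDiffOn_univ]
    exact D.chart.curve_contMDiffOn (c := fun t : ℝ ↦ c t.sigmoid)
      ((show ContDiff ℝ 1 c by fun_prop).comp (contDiff_sigmoid.of_le le_top)) (fun t _ ↦ htarget t)
  · intro t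
    rw [region_eq]
    exact ⟨_, hcIoo t, rfl⟩
  · intro t
    have h0 := Real.sigmoid_pos t
    have h1 := Real.sigmoid_lt_one t
    have hs := Real.hasDerivAt_sigmoid t
    have hd : HasDerivAt (fun t : ℝ ↦ c t.sigmoid)
        (t.sigmoid * (1 - t.sigmoid) * (D.u₁ - D.u₀),
          t.sigmoid * (1 - t.sigmoid) * (D.v₁ - D.v₀)) t :=
      ((hs.mul_const _).const_add _).prodMk ((hs.mul_const _).const_add _)
    have h2 : 0 < t.sigmoid * (1 - t.sigmoid) := mul_pos h0 (sub_pos.mpr h1)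
    have h3 := mul_pos h2 (sub_pos.mpr hu)
    have h4 := mul_pos h2 (sub_pos.mpr hv)
    exact ⟨_, D.chart.curve_hasVelocity hd (htarget t),
      D.chart.futureCausal_frame (htarget t) h3.le h4.le
        fun h ↦ h3.ne' (congrArg Prod.fst h)⟩
  · intro r hr hl
    have := hlim Real.tendsto_sigmoid_atTop (by
      rw [hc1]; exact D.mem_target ⟨hu.le, le_rfl⟩ ⟨hv.le, le_rfl⟩)
    rw [hc1, D.q_eq] at this
    exact hq (tendsto_nhds_unique hl this ▸ hr)
  · intro r hr hl
    have := hlim Real.tendsto_sigmoid_atBot (by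
      rw [hc0]; exact D.mem_target ⟨le_rfl, hu.le⟩ ⟨le_rfl, hv.le⟩)
    rw [hc0, D.p_eq] at this
    exact hp (tendsto_nhds_unique hl this ▸ hr)

end CausalDiamond
end LorentzSurface

namespace LorentzSurface

variable {X : Type u} [TopologicalSpace X]
  [ChartedSpace (EuclideanSpace ℝ (Fin 2)) X] [IsManifold (𝓡 2) ∞ X] {M : LorentzSurface X}

/-! ### The net axioms -/

section Inclusions

variable {C : Type u₁} [Bicategory.{w₁, v₁} C] [Bicategory.IsLocallyGroupoid C]
  (Z : Pseudofunctor (PathTwoCat M) C) {D D' D'' D₁ D₂ : CausalDiamond M}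

lemma carries_inclusionHom (hD : D'.closedRegion ⊆ D.closedRegion)
    (a : End (Z.map D'.pastBoundary)) :
    Z.Carries (⟨CausalDiamond.sweep_inclusion hD⟩ :
      D.fromLeft (hD D'.left_mem) ≫ D'.pastBoundary ≫ D.toRight (hD D'.right_mem) ⟶
        D.pastBoundary) a (inclusionHom Z hD a) := by
  rw [inclusionHom_apply]
  simp [Pseudofunctor.Carries, Pseudofunctor.Intertwines, Pseudofunctor.extendLeft,
    Pseudofunctor.extendRight, inclusionIso]

lemma inclusionHom_self (hD : D.closedRegion ⊆ D.closedRegion) (a : End (Z.map D.pastBoundary)) :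
    inclusionHom Z hD a = a :=
  (carries_inclusionHom Z hD a).eq_right
    (Pseudofunctor.Carries.refl CausalDiamond.fromLeft_left CausalDiamond.toRight_right _ a)

lemma inclusionHom_comp (h' : D''.closedRegion ⊆ D'.closedRegion)
    (h : D'.closedRegion ⊆ D.closedRegion) (h'' : D''.closedRegion ⊆ D.closedRegion)
    (a : End (Z.map D''.pastBoundary)) :
    inclusionHom Z h'' a = inclusionHom Z h (inclusionHom Z h' a) := by
  have σ : D.fromLeft (h D'.left_mem) ≫ D'.fromLeft (h' D''.left_mem) ⟶
    D.fromLeft (h'' D''.left_mem) := ⟨CausalDiamond.sweep_fromLeft h (h' D''.left_mem)⟩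
  have τ : D'.toRight (h' D''.right_mem) ≫ D.toRight (h D'.right_mem) ⟶
    D.toRight (h'' D''.right_mem) := ⟨CausalDiamond.sweep_toRight h (h' D''.right_mem)⟩
  have s : (D.fromLeft (h D'.left_mem) ≫ D'.fromLeft (h' D''.left_mem)) ≫ D''.pastBoundary ≫
      D'.toRight (h' D''.right_mem) ≫ D.toRight (h D'.right_mem) ⟶ D.pastBoundary :=
    -- The two-stage path is deformed down to the direct one and then to the past boundary; both
    -- sides of the claim are compared along this 2-morphism.
    (σ ▷ _) ≫ (_ ◁ _ ◁ τ) ≫ ⟨CausalDiamond.sweep_inclusion h''⟩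
  have k₁ := (carries_inclusionHom Z h'' a).of_hom σ τ s
  have k₂ := (carries_inclusionHom Z h' a).trans (carries_inclusionHom Z h _) s
  exact k₁.eq_right k₂

lemma inclusionHom_commute_of_rightwards (h₁ : D₁.closedRegion ⊆ D.closedRegion)
    (h₂ : D₂.closedRegion ⊆ D.closedRegion)
    (h : D.Rightwards (D.chart.toChart D₁.right) (D.chart.toChart D₂.left))
    (a₁ : End (Z.map D₁.pastBoundary)) (a₂ : End (Z.map D₂.pastBoundary)) :
    Commute (inclusionHom Z h₁ a₁) (inclusionHom Z h₂ a₂) :=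
  -- Multiplication in `End` is composition in the opposite order, hence the final `symm`.
  ((carries_inclusionHom Z h₁ a₁).commute (CausalDiamond.bridge h₁ h₂ h)
    ⟨CausalDiamond.sweep_bridge_left h₁ h₂ h⟩ ⟨CausalDiamond.sweep_bridge_right h₁ h₂ h⟩
    (carries_inclusionHom Z h₂ a₂)).symm

variable {Z} in
lemma HorizontallyInjective.injective_inclusionHom (hZ : HorizontallyInjective Z)
    (hD : D'.closedRegion ⊆ D.closedRegion) : Function.Injective (inclusionHom Z hD) :=
  (inclusionIso Z hD).conj.injective.comp
    (((hZ (D.fromLeft (hD D'.left_mem)) _).1 _ _).comp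
      ((hZ (D.toRight (hD D'.right_mem)) _).2 _ _))

/-- Whiskering is full on both sides because it is an equivalence, and conjugation by an isomorphism
is bijective. -/
lemma OneMorphismsInvertible.surjective_inclusionHom (hC : OneMorphismsInvertible C)
    (hD : D'.closedRegion ⊆ D.closedRegion) : Function.Surjective (inclusionHom Z hD) := by
  have := hC.isEquivalence_precomp (Z.map (D.fromLeft (hD D'.left_mem))) (Z.obj ⟨D.right⟩)
  have := hC.isEquivalence_postcomp (Z.map (D.toRight (hD D'.right_mem))) (Z.obj ⟨D'.left⟩)
  exact (inclusionIso Z hD).conj.surjective.comp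
    ((Bicategory.precomp _ (Z.map (D.fromLeft (hD D'.left_mem)))).map_surjective.comp
      (Bicategory.postcomp _ (Z.map (D.toRight (hD D'.right_mem)))).map_surjective)

/-! ### Net, locality and time slice for the assignment of `Z` -/

variable [T2Space X]

variable {Z} in
lemma HorizontallyInjective.isNet (hZ : HorizontallyInjective Z) : (netOf Z).IsNet where
  map_id _ := MonoidHom.ext (inclusionHom_self Z subset_rfl)
  map_comp h' h := MonoidHom.ext (inclusionHom_comp Z (CausalSubset.closedRegion_mono h')
    (CausalSubset.closedRegion_mono h) (CausalSubset.closedRegion_mono (h'.trans h)))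
  injective h := hZ.injective_inclusionHom (CausalSubset.closedRegion_mono h)

variable {Z} in
lemma HorizontallyInjective.isLocalNet_restrict (hZ : HorizontallyInjective Z) (Y : Set X) :
    ((netOf Z).restrict Y).IsLocalNet where
  map_id O := hZ.isNet.map_id O.toUniv
  map_comp {O'' O' O} h' h :=
    hZ.isNet.map_comp (O'' := O''.toUniv) (O' := O'.toUniv) (O := O.toUniv) h' h
  injective {O' O} h := hZ.isNet.injective (O' := O'.toUniv) (O := O.toUniv) h
  commute {O₁ O₂ O} h₁ h₂ hs a₁ a₂ := by
    -- The diamond chosen for `O` as a causal subset of `X` need not come from a hyperbolic set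
    -- inside `Y`, while separation is only known in `Y`. So the left-right order is found in a
    -- diamond `E` over `Y` and then moved to the chosen one by a change of coordinates.
    obtain ⟨E, hE, hEO⟩ := O.exists_diamond
    have e₁ : O₁.toUniv.diamond.closedRegion ⊆ E.closedRegion :=
      CausalDiamond.closedRegion_mono (by rw [CausalSubset.diamond_region, hEO]; exact h₁)
    have e₂ : O₂.toUniv.diamond.closedRegion ⊆ E.closedRegion :=
      CausalDiamond.closedRegion_mono (by rw [CausalSubset.diamond_region, hEO]; exact h₂)
    have e : E.closedRegion ⊆ O.toUniv.diamond.closedRegion :=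
      CausalDiamond.closedRegion_mono (by rw [CausalSubset.diamond_region, hEO]; exact subset_rfl)
    have hs' : M.SpacelikeSeparated E.Y O₁.toUniv.diamond.region O₂.toUniv.diamond.region := by
      rw [CausalSubset.diamond_region, CausalSubset.diamond_region]
      exact hs.mono hE
    rcases CausalDiamond.rightwards_or_rightwards e₁ e₂ hs' with h | h
    · have h' := h.coord e
      rw [E.symm_coord (e₁ (CausalDiamond.right_mem _)),
        E.symm_coord (e₂ (CausalDiamond.left_mem _))] at h'
      exact inclusionHom_commute_of_rightwards Z _ _ h' a₁ a₂
    · have h' := h.coord e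
      rw [E.symm_coord (e₂ (CausalDiamond.right_mem _)),
        E.symm_coord (e₁ (CausalDiamond.left_mem _))] at h'
      exact (inclusionHom_commute_of_rightwards Z _ _ h' a₂ a₁).symm

lemma OneMorphismsInvertible.timeSlice_restrict (hC : OneMorphismsInvertible C) (Y : Set X) :
    ((netOf Z).restrict Y).TimeSlice := by
  intro O Sig hSig 𝒰 h𝒰 hcov
  obtain ⟨E, -, hEO⟩ := O.exists_diamond
  obtain ⟨γ, hγ⟩ := E.exists_inextendibleCausalCurve
  rw [hEO] at hγ
  -- The Cauchy surface has a point, so some `U` belongs to the cover; the inclusion map of this one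
  -- `U` is already surjective.
  obtain ⟨t, ht, -⟩ := hSig.2 γ hγ
  obtain ⟨U, hU, -⟩ := mem_iUnion₂.mp (hcov ht)
  refine eq_univ_of_forall fun a ↦ mem_iUnion₂.mpr ⟨U, hU, ?_⟩
  exact hC.surjective_inclusionHom Z _ a

end Inclusions

end LorentzSurface
theorem mainTheorem4 {X : Type u} [TopologicalSpace X] [T2Space X]
    [ChartedSpace (EuclideanSpace ℝ (Fin 2)) X] [IsManifold (𝓡 2) ∞ X] (M : LorentzSurface X)
    {C : Type u₁} [Bicategory.{w₁, v₁} C] [Bicategory.IsLocallyGroupoid C]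
    (Z : Pseudofunctor M.PathTwoCat C) :
    (LorentzSurface.HorizontallyInjective Z →
      (LorentzSurface.netOf Z).IsNet ∧
        ∀ Y : Set X, M.GloballyHyperbolic Y → ((LorentzSurface.netOf Z).restrict Y).IsLocalNet) ∧
    (LorentzSurface.OneMorphismsInvertible C →
      (LorentzSurface.netOf Z).IsNet ∧
        ∀ Y : Set X, M.GloballyHyperbolic Y →
          ((LorentzSurface.netOf Z).restrict Y).IsLocalNet ∧
          ((LorentzSurface.netOf Z).restrict Y).TimeSlice) := by
  refine ⟨fun hZ ↦ ⟨hZ.isNet, fun Y _ ↦ hZ.isLocalNet_restrict Y⟩, fun hC ↦ ?_⟩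
  have hZ : LorentzSurface.HorizontallyInjective Z := hC.horizontallyInjective Z
  exact ⟨hZ.isNet, fun Y _ ↦ ⟨hZ.isLocalNet_restrict Y, hC.timeSlice_restrict Z Y⟩⟩
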